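/- Let $\{E_k\}_{k\in\mathbb Z}$ be the canonical basis of $\ell^2(\mathbb Z)$, let $U$ be the bilateral shift, $UE_k=E_{k+1}$, and for a bounded function $a:\mathbb Z\to\mathbb C$ let $a(\mathbb K)$ be the diagonal operator $a(\mathbb K)E_k=a(k)E_k$. Let $A$ (the quantum cylinder) be the C$^*$-algebra of operators on $\ell^2(\mathbb Z)$ generated by $U$ and all $a(\mathbb K)$ for which the limits $a(\pm\infty)=\lim_{k\to\pm\infty}a(k)$ exist (they may differ), and let $\mathcal A\subset A$ be the subalgebra of all finite sums $\sum_n U^na_n(\mathbb K)$, $n\in\mathbb Z$, where each $a_n$ is constant near $+\infty$ and constant near $-\infty$. A derivation $d:\mathcal A\to A$ is a linear map with $d(ab)=d(a)b+a\,d(b)$; it is approximately inner if there are $x_n\in A$ with $d(a)=\lim_{n\to\infty}[x_n,a]$ in norm for every $a\in\mathcal A$. Let $P_{\ge0}$ and $P_0$ be the orthogonal projections onto the closed spans of $\{E_k:k\ge0\}$ and $\{E_0\}$, and let $P_{<0}=I-P_{\ge0}$. For $f,g\in C(S^1)$ put $T_{f,g}=P_{\ge0}f(U)P_{\ge0}+P_{<0}g(U)P_{<0}$,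 and let $d_{f,g}:\mathcal A\to A$ be the unique derivation with $$d_{f,g}(U)=U\,T_{f,g},\qquad d_{f,g}(P_{\ge0})=d_{f,g}(P_0)=0 .$$ Let $\mathcal K$ be the ideal of compact operators on $\ell^2(\mathbb Z)$, and identify $A/\mathcal K$ with $C(S^1)\oplus C(S^1)$ so that the class of $T_{p,q}$ is $(p,q)$; functions on $S^1$ are written as functions of $x$ through $e^{ix}$. **Theorem.** 1. For all $f,g\in C(S^1)$, the derivation $d_{f,g}$ is a lift of the boundary derivation $\delta_{f,g}=\bigl(f\,\tfrac1i\tfrac{d}{dx},\ g\,\tfrac1i\tfrac{d}{dx}\bigr)$: for every $a\in\mathcal A$, the class $(p,q)$ of $a$ in $A/\mathcal K$ consists of differentiable functions with continuous derivatives, and the class of $d_{f,g}(a)$ is $\bigl(f\,\tfrac1i p',\ g\,\tfrac1i q'\bigr)$. 2. Let $d:\mathcal A\to A$ be any derivation. There are unique functions $f,g\in C(S^1)$ such that $d=\tilde d+d_{f,g}$, where $\tilde d:\mathcal A\to A$ is an approximately inner derivation. -/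

import Mathlib

open Filter Topology

namespace QuantumCylinder

open scoped ENNReal

/-- The Hilbert space `ℓ²(ℤ)`. -/
abbrev L2Z : Type := lp (fun _ : ℤ => ℂ) 2

/-- Bounded operators on `ℓ²(ℤ)`. -/
abbrev Op : Type := L2Z →L[ℂ] L2Z

/-- Bounded functions `ℤ → ℂ`. -/
abbrev BddSeq : Type := lp (fun _ : ℤ => ℂ) ∞

/-- The canonical basis vector `E_k` of `ℓ²(ℤ)`. -/
noncomputable def E (k : ℤ) : L2Z := lp.single 2 k (1 : ℂ)

theorem shift_memℓp (m : ℤ) (f : L2Z) : Memℓp (fun k : ℤ => f (k - m)) 2 := by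
  have h := (memℓp_gen_iff (p := 2) (by norm_num)).1 (lp.memℓp f)
  exact (memℓp_gen_iff (p := 2) (by norm_num)).2 ((Equiv.subRight m).summable_iff.2 h)

/-- The bilateral shift `U E_k = E_{k+1}`, that is `(U f)(k) = f (k - 1)`, as an isometric
automorphism of `ℓ²(ℤ)`. -/
noncomputable def shiftEquiv : L2Z ≃ₗᵢ[ℂ] L2Z where
  toFun f := ⟨fun k => f (k - 1), shift_memℓp 1 f⟩
  invFun f := ⟨fun k => f (k - -1), shift_memℓp (-1) f⟩
  map_add' f g := by ext k; rfl
  map_smul' c f := by ext k; rfl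
  left_inv f := by ext k; simp
  right_inv f := by ext k; simp
  norm_map' f := by
    rw [lp.norm_eq_tsum_rpow (by norm_num), lp.norm_eq_tsum_rpow (by norm_num)]
    congr 1
    exact (Equiv.subRight (1 : ℤ)).tsum_eq (fun k => ‖f k‖ ^ (2 : ℝ≥0∞).toReal)

/-- The bilateral shift as an element of the unitary group of bounded operators; its integer
powers are taken in that group. -/
noncomputable def U : unitary Op := Unitary.linearIsometryEquiv.symm shiftEquiv

/-- The diagonal operator `a(𝕂) E_k = a(k) E_k`, that is `(a(𝕂) f)(k) = a(k) f(k)`. -/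
noncomputable def diag (a : BddSeq) : Op :=
  lp.mapCLM 2 (fun k => a k • ContinuousLinearMap.id ℂ ℂ) (norm_nonneg a) (fun k => by
    have h := lp.norm_apply_le_norm (by simp) a k
    rw [norm_smul, ContinuousLinearMap.norm_id, mul_one]
    exact h)

/-- `a ∈ c(ℤ)`: `a` has a limit at `+∞` and a (possibly different) limit at `-∞`. -/
def IsConvergent (a : BddSeq) : Prop :=
  ∃ r s : ℂ, Tendsto (fun k : ℤ => a k) atTop (𝓝 r) ∧ Tendsto (fun k : ℤ => a k) atBot (𝓝 s)

/-- `a` is constant near `+∞` and constant near `-∞`. -/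
def IsEventuallyConstant (a : BddSeq) : Prop :=
  ∃ (k₀ : ℕ) (r s : ℂ), ∀ k : ℤ, ((k₀ : ℤ) ≤ k → a k = r) ∧ (k ≤ -(k₀ : ℤ) → a k = s)

/-- The quantum cylinder: the C*-algebra generated by `U` and the diagonal operators `a(𝕂)`,
`a ∈ c(ℤ)`. -/
noncomputable def cylinder : StarSubalgebra ℂ Op :=
  (StarAlgebra.adjoin ℂ ({(U : Op)} ∪ diag '' {a | IsConvergent a})).topologicalClosure

@[simp] theorem U_apply (f : L2Z) (k : ℤ) : (U : Op) f k = f (k - 1) := rfl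

@[simp] theorem U_inv_apply (f : L2Z) (k : ℤ) : ((U⁻¹ : unitary Op) : Op) f k = f (k + 1) := by
  have h : (U : Op) (((U⁻¹ : unitary Op) : Op) f) = f := by
    rw [← mul_apply_eq_comp, ← Submonoid.coe_mul]
    simp
  conv_rhs => rw [← h]
  simp

@[simp] theorem U_zpow_apply (n : ℤ) (f : L2Z) (k : ℤ) :
    ((U ^ n : unitary Op) : Op) f k = f (k - n) := by
  induction n using Int.induction_on generalizing k with
  | zero => simp
  | succ n ih =>
    rw [add_comm, zpow_add, zpow_one, Submonoid.coe_mul, mul_apply_eq_comp, U_apply, ih]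
    exact congrArg f (by ring)
  | pred n ih =>
    rw [sub_eq_add_neg, add_comm, zpow_add, zpow_neg_one, Submonoid.coe_mul,
      mul_apply_eq_comp, U_inv_apply, ih]
    exact congrArg f (by ring)

@[simp] theorem diag_apply (a : BddSeq) (f : L2Z) (k : ℤ) : diag a f k = a k * f k := rfl

theorem op_ext {S T : Op} (h : ∀ f k, S f k = T f k) : S = T := by
  ext f k; exact h f k

/-- `a(𝕂 + n)`: the translate of a bounded function on `ℤ`. -/
noncomputable def translate (n : ℤ) (a : BddSeq) : BddSeq :=
  ⟨fun k => a (k + n), memℓp_infty (by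
    obtain ⟨C, hC⟩ := (lp.memℓp a).bddAbove
    exact ⟨C, by rintro _ ⟨k, rfl⟩; exact hC ⟨k + n, rfl⟩⟩)⟩

@[simp] theorem translate_apply (n : ℤ) (a : BddSeq) (k : ℤ) : translate n a k = a (k + n) := rfl

theorem IsEventuallyConstant.translate {a : BddSeq} (h : IsEventuallyConstant a) (n : ℤ) :
    IsEventuallyConstant (translate n a) := by
  obtain ⟨N, r, s, h⟩ := h
  refine ⟨N + n.natAbs, r, s, fun k => ⟨fun hk => (h _).1 ?_, fun hk => (h _).2 ?_⟩⟩ <;>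
    push_cast at hk <;> have := neg_abs_le n <;> have := le_abs_self n <;> omega

theorem IsEventuallyConstant.mul {a b : BddSeq} (ha : IsEventuallyConstant a)
    (hb : IsEventuallyConstant b) : IsEventuallyConstant (a * b) := by
  obtain ⟨N, r, s, h⟩ := ha
  obtain ⟨M, t, u, h'⟩ := hb
  refine ⟨N + M, r * t, s * u, fun k => ⟨fun hk => ?_, fun hk => ?_⟩⟩ <;>
    push_cast at hk <;> rw [lp.infty_coeFn_mul, Pi.mul_apply]
  · rw [(h k).1 (by omega), (h' k).1 (by omega)]
  · rw [(h k).2 (by omega), (h' k).2 (by omega)]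

theorem IsEventuallyConstant.isConvergent {a : BddSeq} (h : IsEventuallyConstant a) :
    IsConvergent a := by
  obtain ⟨N, r, s, h⟩ := h
  exact ⟨r, s, tendsto_const_nhds.congr' ((eventually_ge_atTop (N : ℤ)).mono
      fun k hk => ((h k).1 hk).symm),
    tendsto_const_nhds.congr' ((eventually_le_atBot (-(N : ℤ))).mono
      fun k hk => ((h k).2 hk).symm)⟩

theorem isEventuallyConstant_one : IsEventuallyConstant 1 := ⟨0, 1, 1, fun _ => ⟨fun _ => rfl, fun _ => rfl⟩⟩

theorem diag_mul_zpow (n : ℤ) (a : BddSeq) :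
    diag a * ((U ^ n : unitary Op) : Op) = ((U ^ n : unitary Op) : Op) * diag (translate n a) :=
  op_ext fun f k => by simp [mul_apply_eq_comp]

/-- The dense subalgebra `𝒜` of the quantum cylinder: all finite sums `∑ Uⁿ aₙ(𝕂)` with `n ∈ ℤ`
and every `aₙ` eventually constant. -/
noncomputable def polyAlg : Subalgebra ℂ Op :=
  (Submodule.span ℂ {T : Op | ∃ (n : ℤ) (a : BddSeq), IsEventuallyConstant a ∧
    T = ((U ^ n : unitary Op) : Op) * diag a}).toSubalgebra
  (Submodule.subset_span ⟨0, 1, isEventuallyConstant_one, op_ext fun f k => by simp⟩)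
  (fun x y hx hy => by
    refine Submodule.span_induction₂ (p := fun x y _ _ => x * y ∈ Submodule.span ℂ _)
      ?_ ?_ ?_ ?_ ?_ ?_ ?_ hx hy
    · rintro _ _ ⟨n, a, ha, rfl⟩ ⟨m, b, hb, rfl⟩
      refine Submodule.subset_span ⟨n + m, translate m a * b, (ha.translate m).mul hb, ?_⟩
      refine op_ext fun f k => ?_
      simp only [mul_apply_eq_comp, U_zpow_apply, diag_apply, translate_apply,
        lp.infty_coeFn_mul, Pi.mul_apply]
      rw [show k - (n + m) + m = k - n by ring, show k - n - m = k - (n + m) by ring, mul_assoc]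
    · intro y _; simp
    · intro x _; simp
    · intro x y z _ _ _ h1 h2; rw [add_mul]; exact Submodule.add_mem _ h1 h2
    · intro x y z _ _ _ h1 h2; rw [mul_add]; exact Submodule.add_mem _ h1 h2
    · intro r x y _ _ h; rw [smul_mul_assoc]; exact Submodule.smul_mem _ _ h
    · intro r x y _ _ h; rw [mul_smul_comm]; exact Submodule.smul_mem _ _ h)

theorem mem_polyAlg {n : ℤ} {a : BddSeq} (ha : IsEventuallyConstant a) :
    ((U ^ n : unitary Op) : Op) * diag a ∈ polyAlg :=
  Submodule.subset_span ⟨n, a, ha, rfl⟩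

theorem U_mem_polyAlg : (U : Op) ∈ polyAlg := by
  have h := mem_polyAlg (n := 1) isEventuallyConstant_one
  rwa [show ((U ^ (1 : ℤ) : unitary Op) : Op) * diag 1 = U from
    op_ext fun f k => by simp [mul_apply_eq_comp]] at h

theorem U_inv_mem_polyAlg : ((U⁻¹ : unitary Op) : Op) ∈ polyAlg := by
  have h := mem_polyAlg (n := -1) isEventuallyConstant_one
  rwa [show ((U ^ (-1 : ℤ) : unitary Op) : Op) * diag 1 = (U⁻¹ : unitary Op) from
    op_ext fun f k => by simp [mul_apply_eq_comp]] at h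

theorem diag_mem_polyAlg {a : BddSeq} (ha : IsEventuallyConstant a) : diag a ∈ polyAlg := by
  simpa using mem_polyAlg (n := 0) ha

/-- The bounded `0/1`-valued function given by a predicate on `ℤ`. -/
noncomputable def indicatorSeq (p : ℤ → Prop) [DecidablePred p] : BddSeq :=
  ⟨fun k => if p k then 1 else 0, memℓp_infty ⟨1, by
    rintro _ ⟨k, rfl⟩; dsimp only; split_ifs <;> simp⟩⟩

@[simp] theorem indicatorSeq_apply (p : ℤ → Prop) [DecidablePred p] (k : ℤ) :
    indicatorSeq p k = if p k then 1 else 0 := rfl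

/-- `P_{≥0}`, the orthogonal projection onto the closed span of `{E_k : k ≥ 0}`. -/
noncomputable def PNonneg : Op := diag (indicatorSeq fun k => 0 ≤ k)

/-- `P_{<0} = I - P_{≥0}`. -/
noncomputable def PNeg : Op := diag (indicatorSeq fun k => k < 0)

/-- `P₀`, the orthogonal projection onto the span of `E_0`. -/
noncomputable def PZero : Op := diag (indicatorSeq fun k => k = 0)

@[simp] theorem PNonneg_apply (f : L2Z) (k : ℤ) : PNonneg f k = if 0 ≤ k then f k else 0 := by
  simp [PNonneg]

@[simp] theorem PNeg_apply (f : L2Z) (k : ℤ) : PNeg f k = if k < 0 then f k else 0 := by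
  simp [PNeg]

@[simp] theorem PZero_apply (f : L2Z) (k : ℤ) : PZero f k = if k = 0 then f k else 0 := by
  simp [PZero]

theorem isEventuallyConstant_nonneg : IsEventuallyConstant (indicatorSeq fun k => 0 ≤ k) :=
  ⟨1, 1, 0, fun k => by
    simp only [indicatorSeq_apply]
    constructor <;> intro h <;> split_ifs <;> first | rfl | omega⟩

theorem isEventuallyConstant_neg : IsEventuallyConstant (indicatorSeq fun k => k < 0) :=
  ⟨1, 0, 1, fun k => by
    simp only [indicatorSeq_apply]
    constructor <;> intro h <;> split_ifs <;> first | rfl | omega⟩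

theorem isEventuallyConstant_zero : IsEventuallyConstant (indicatorSeq fun k => k = 0) :=
  ⟨1, 0, 0, fun k => by
    simp only [indicatorSeq_apply]
    constructor <;> intro h <;> split_ifs <;> first | rfl | omega⟩

theorem PNonneg_mem_polyAlg : PNonneg ∈ polyAlg := diag_mem_polyAlg isEventuallyConstant_nonneg

theorem PZero_mem_polyAlg : PZero ∈ polyAlg := diag_mem_polyAlg isEventuallyConstant_zero

/-- `f(U)` for `f ∈ C(S¹)`, by the continuous functional calculus of the unitary `U`, whose
spectrum lies in the unit circle; the value `0` given to `f` off the circle plays no role. -/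
noncomputable def circleFun (f : C(Circle, ℂ)) : Op :=
  cfc (Function.extend ((↑) : Circle → ℂ) f 0) (U : Op)

/-- The Toeplitz-like operator `T_{f,g} = P_{≥0} f(U) P_{≥0} + P_{<0} g(U) P_{<0}`. -/
noncomputable def toeplitz (f g : C(Circle, ℂ)) : Op :=
  PNonneg * circleFun f * PNonneg + PNeg * circleFun g * PNeg

theorem U_mem_cylinder : (U : Op) ∈ cylinder :=
  StarSubalgebra.le_topologicalClosure _ (StarAlgebra.subset_adjoin ℂ _ (Or.inl rfl))

theorem U_inv_mem_cylinder : ((U⁻¹ : unitary Op) : Op) ∈ cylinder := by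
  have h := star_mem U_mem_cylinder
  rwa [← Unitary.coe_star] at h

theorem diag_mem_cylinder {a : BddSeq} (ha : IsConvergent a) : diag a ∈ cylinder :=
  StarSubalgebra.le_topologicalClosure _ (StarAlgebra.subset_adjoin ℂ _ (Or.inr ⟨a, ha, rfl⟩))

theorem circleFun_mem_cylinder (f : C(Circle, ℂ)) : circleFun f ∈ cylinder := by
  have : IsClosed (cylinder : Set Op) := StarSubalgebra.isClosed_topologicalClosure _
  exact cfc_mem (𝕜 := ℂ) (𝕜' := ℂ) _ U_mem_cylinder

theorem toeplitz_mem_cylinder (f g : C(Circle, ℂ)) : toeplitz f g ∈ cylinder := by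
  have h1 : PNonneg ∈ cylinder := diag_mem_cylinder isEventuallyConstant_nonneg.isConvergent
  have h2 : PNeg ∈ cylinder := diag_mem_cylinder isEventuallyConstant_neg.isConvergent
  exact add_mem (mul_mem (mul_mem h1 (circleFun_mem_cylinder f)) h1)
    (mul_mem (mul_mem h2 (circleFun_mem_cylinder g)) h2)

theorem U_mul_U_inv : (U : Op) * ((U⁻¹ : unitary Op) : Op) = 1 := by
  rw [← Submonoid.coe_mul]; simp

theorem U_inv_mul_U : ((U⁻¹ : unitary Op) : Op) * (U : Op) = 1 := by
  rw [← Submonoid.coe_mul]; simp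

/-- A derivation `d : 𝒜 → A`: a linear map satisfying the Leibniz rule. -/
def IsDerivation (d : polyAlg →ₗ[ℂ] cylinder) : Prop :=
  ∀ a b : polyAlg, (d (a * b) : Op) = (d a : Op) * (b : Op) + (a : Op) * (d b : Op)

/-- `d` is approximately inner: there are `xₙ ∈ A` with `d(a) = lim [xₙ, a]` in norm, for every
`a ∈ 𝒜`. -/
def IsApproximatelyInner (d : polyAlg →ₗ[ℂ] cylinder) : Prop :=
  ∃ x : ℕ → cylinder, ∀ a : polyAlg,
    Tendsto (fun n => (x n : Op) * (a : Op) - (a : Op) * (x n : Op)) atTop (𝓝 (d a : Op))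

/-- The property that characterizes `d_{f,g}`: a derivation `D : 𝒜 → A` with `D(U) = U T_{f,g}`
and `D(P_{≥0}) = D(P₀) = 0`. -/
structure IsBoundaryDerivation (f g : C(Circle, ℂ)) (D : polyAlg →ₗ[ℂ] cylinder) : Prop where
  isDerivation : IsDerivation D
  map_U : (D ⟨U, U_mem_polyAlg⟩ : Op) = (U : Op) * toeplitz f g
  map_PNonneg : D ⟨PNonneg, PNonneg_mem_polyAlg⟩ = 0
  map_PZero : D ⟨PZero, PZero_mem_polyAlg⟩ = 0

/-! Existence and uniqueness of the derivation `d_{f,g}`. -/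

/-- Finitely supported vectors inside `ℓ²(ℤ)`. -/
noncomputable def fin : (ℤ →₀ ℂ) →ₗ[ℂ] L2Z := Finsupp.linearCombination ℂ E

theorem E_apply (k j : ℤ) : E k j = if j = k then 1 else 0 := by
  simp [E, Pi.single_apply]

theorem fin_single (k : ℤ) (c : ℂ) : fin (Finsupp.single k c) = c • E k := by
  simp [fin]

theorem fin_apply (v : ℤ →₀ ℂ) (k : ℤ) : fin v k = v k := by
  induction v using Finsupp.induction_linear with
  | zero => simp
  | add f g hf hg => simp [hf, hg]
  | single j c => rw [fin_single]; simp [E_apply, Finsupp.single_apply, eq_comm]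

theorem fin_injective : Function.Injective fin := fun v w h => by
  ext k; rw [← fin_apply, h, fin_apply]

theorem eq_of_comp_fin {S T : Op} (h : ∀ v, S (fin v) = T (fin v)) : S = T := by
  refine lp.ext_continuousLinearMap (by norm_num) fun i => ?_
  ext1
  have := h (Finsupp.single i 1)
  rw [fin_single, one_smul] at this
  exact this

/-- `[X, a] = B` on finitely supported vectors, for an unbounded operator `X` defined on these. -/
def Rel (X : (ℤ →₀ ℂ) →ₗ[ℂ] L2Z) (a B : Op) : Prop :=
  ∃ a' : (ℤ →₀ ℂ) →ₗ[ℂ] (ℤ →₀ ℂ), (∀ v, fin (a' v) = a (fin v)) ∧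
    ∀ v, B (fin v) = X (a' v) - a (X v)

theorem Rel.unique {X : (ℤ →₀ ℂ) →ₗ[ℂ] L2Z} {a B C : Op} (h : Rel X a B) (h' : Rel X a C) :
    B = C := by
  obtain ⟨a', h1, h2⟩ := h
  obtain ⟨a'', h3, h4⟩ := h'
  refine eq_of_comp_fin fun v => ?_
  have : a' v = a'' v := fin_injective (by rw [h1, h3])
  rw [h2, h4, this]

theorem Rel.add {X : (ℤ →₀ ℂ) →ₗ[ℂ] L2Z} {a b B C : Op} (h : Rel X a B) (h' : Rel X b C) :
    Rel X (a + b) (B + C) := by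
  obtain ⟨a', h1, h2⟩ := h
  obtain ⟨b', h3, h4⟩ := h'
  refine ⟨a' + b', fun v => by simp [h1, h3], fun v => ?_⟩
  simp [h2, h4]; abel

theorem Rel.smul {X : (ℤ →₀ ℂ) →ₗ[ℂ] L2Z} {a B : Op} (h : Rel X a B) (c : ℂ) :
    Rel X (c • a) (c • B) := by
  obtain ⟨a', h1, h2⟩ := h
  exact ⟨c • a', fun v => by simp [h1], fun v => by simp [h2, smul_sub]⟩

theorem Rel.mul {X : (ℤ →₀ ℂ) →ₗ[ℂ] L2Z} {a b B C : Op} (h : Rel X a B) (h' : Rel X b C) :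
    Rel X (a * b) (B * b + a * C) := by
  obtain ⟨a', h1, h2⟩ := h
  obtain ⟨b', h3, h4⟩ := h'
  refine ⟨a' ∘ₗ b', fun v => by simp [h1, h3], fun v => ?_⟩
  simp [h4, ← h3, h2]

theorem Rel.algebraMap (X : (ℤ →₀ ℂ) →ₗ[ℂ] L2Z) (c : ℂ) : Rel X (algebraMap ℂ Op c) 0 :=
  ⟨c • LinearMap.id, fun v => by simp [Algebra.algebraMap_eq_smul_one],
    fun v => by simp [Algebra.algebraMap_eq_smul_one]⟩

/-- The generators `U`, `U⁻¹`, `P_{≥0}`, `P₀`. -/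
noncomputable def gens : Set Op := {(U : Op), ((U⁻¹ : unitary Op) : Op), PNonneg, PZero}

theorem polyAlg_le_adjoin : polyAlg ≤ Algebra.adjoin ℂ gens := by
  have hU : (U : Op) ∈ Algebra.adjoin ℂ gens := Algebra.subset_adjoin (by simp [gens])
  have hV : ((U⁻¹ : unitary Op) : Op) ∈ Algebra.adjoin ℂ gens :=
    Algebra.subset_adjoin (by simp [gens])
  have hP : PNonneg ∈ Algebra.adjoin ℂ gens := Algebra.subset_adjoin (by simp [gens])
  have hZ : PZero ∈ Algebra.adjoin ℂ gens := Algebra.subset_adjoin (by simp [gens])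
  have hUn : ∀ n : ℤ, ((U ^ n : unitary Op) : Op) ∈ Algebra.adjoin ℂ gens := by
    intro n
    induction n using Int.induction_on with
    | zero => simp [one_mem]
    | succ n ih => rw [zpow_add, zpow_one, Submonoid.coe_mul]; exact mul_mem ih hU
    | pred n ih =>
      rw [sub_eq_add_neg, zpow_add, zpow_neg_one, Submonoid.coe_mul]; exact mul_mem ih hV
  have hdiag : ∀ a, IsEventuallyConstant a → diag a ∈ Algebra.adjoin ℂ gens := by
    rintro a ⟨N, r, s, h⟩
    have key : diag a = r • PNonneg + s • (1 - PNonneg) + ∑ j ∈ Finset.Ioo (-(N : ℤ)) N,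
        (a j - if 0 ≤ j then r else s) •
          (((U ^ j : unitary Op) : Op) * PZero * ((U ^ (-j) : unitary Op) : Op)) := by
      refine op_ext fun f k => ?_
      simp only [_root_.add_apply, _root_.sum_apply, lp.coeFn_add,
        lp.coeFn_sum, Pi.add_apply, Finset.sum_apply, _root_.smul_apply,
        lp.coeFn_smul, Pi.smul_apply, mul_apply_eq_comp, U_zpow_apply, PZero_apply,
        PNonneg_apply, diag_apply, _root_.sub_apply, lp.coeFn_sub, Pi.sub_apply,
        one_apply_eq_self, smul_eq_mul]
      have e : ∀ j : ℤ, (a j - if 0 ≤ j then r else s) *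
          (if k - j = 0 then f (k - j - -j) else 0) =
          if k = j then (a k - if 0 ≤ k then r else s) * f k else 0 := by
        intro j
        by_cases hj : k = j
        · subst hj; simp
        · have hj' : k - j ≠ 0 := sub_ne_zero.2 hj
          simp [hj, hj']
      rw [Finset.sum_congr rfl fun j _ => e j, Finset.sum_ite_eq]
      simp only [Finset.mem_Ioo]
      by_cases hk : -(N : ℤ) < k ∧ k < N
      · rw [if_pos hk]; split_ifs <;> ring
      · rw [if_neg hk]
        by_cases h0 : 0 ≤ k
        · rw [if_pos h0, (h k).1 (by omega)]; ring
        · rw [if_neg h0, (h k).2 (by omega)]; ring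
    rw [key]
    refine add_mem (add_mem (Subalgebra.smul_mem _ hP _)
      (Subalgebra.smul_mem _ (sub_mem (one_mem _) hP) _)) (sum_mem fun j _ => ?_)
    exact Subalgebra.smul_mem _ (mul_mem (mul_mem (hUn j) hZ) (hUn (-j))) _
  intro x hx
  change x ∈ Submodule.span ℂ _ at hx
  have hle : Submodule.span ℂ {T : Op | ∃ (n : ℤ) (a : BddSeq), IsEventuallyConstant a ∧
    T = ((U ^ n : unitary Op) : Op) * diag a} ≤ Subalgebra.toSubmodule (Algebra.adjoin ℂ gens) := by
    refine Submodule.span_le.2 ?_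
    rintro _ ⟨n, a, ha, rfl⟩
    exact (Algebra.adjoin ℂ gens).mul_mem (hUn n) (hdiag a ha)
  exact hle hx

section column

variable (T : Op)

/-- Columns of the unbounded operator: nonnegative indices. -/
noncomputable def colPos : ℕ → L2Z
  | 0 => 0
  | n + 1 => (U : Op) (colPos n + T (E n))

/-- Columns of the unbounded operator: nonpositive indices. -/
noncomputable def colNeg : ℕ → L2Z
  | 0 => 0
  | n + 1 => ((U⁻¹ : unitary Op) : Op) (colNeg n) - T (E (-(n + 1 : ℤ)))

/-- Columns `x_k` with `x_0 = 0` and `x_{k+1} = U (x_k + T E_k)`. -/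
noncomputable def col : ℤ → L2Z
  | Int.ofNat n => colPos T n
  | Int.negSucc n => colNeg T (n + 1)

theorem col_add_one (k : ℤ) : col T (k + 1) = (U : Op) (col T k + T (E k)) := by
  have hU : ∀ x, (U : Op) (((U⁻¹ : unitary Op) : Op) x) = x := fun x => by
    rw [← mul_apply_eq_comp, U_mul_U_inv, one_apply_eq_self]
  match k with
  | Int.ofNat n => rfl
  | Int.negSucc 0 =>
    change colPos T 0 = (U : Op) (colNeg T 1 + T (E (Int.negSucc 0)))
    have h : (Int.negSucc 0) = -((0 : ℕ) + 1 : ℤ) := rfl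
    rw [h]
    simp only [colNeg, colPos, sub_add_cancel, hU]
  | Int.negSucc (n + 1) =>
    change colNeg T (n + 1) = (U : Op) (colNeg T (n + 2) + T (E (Int.negSucc (n + 1))))
    have h : (Int.negSucc (n + 1)) = -((n + 1 : ℕ) + 1 : ℤ) := rfl
    rw [h, colNeg.eq_2 T (n + 1), sub_add_cancel, hU]

variable {T}

theorem colPos_supp (hT : ∀ k j : ℤ, 0 ≤ k → j < 0 → T (E k) j = 0) (n : ℕ) :
    ∀ j : ℤ, j ≤ 0 → colPos T n j = 0 := by
  induction n with
  | zero => intro j _; rfl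
  | succ n ih =>
    intro j hj
    rw [colPos, U_apply, lp.coeFn_add, Pi.add_apply, ih _ (by omega),
      hT _ _ (by omega) (by omega), add_zero]

theorem colNeg_supp (hT : ∀ k j : ℤ, k < 0 → 0 ≤ j → T (E k) j = 0) (n : ℕ) :
    ∀ j : ℤ, 0 ≤ j → colNeg T n j = 0 := by
  induction n with
  | zero => intro j _; rfl
  | succ n ih =>
    intro j hj
    rw [colNeg, lp.coeFn_sub, Pi.sub_apply, U_inv_apply, ih _ (by omega),
      hT _ _ (by omega) (by omega), sub_zero]

theorem col_supp_nonneg (hT : ∀ k j : ℤ, 0 ≤ k → j < 0 → T (E k) j = 0) (k j : ℤ) (hk : 0 ≤ k)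
    (hj : j ≤ 0) : col T k j = 0 := by
  match k, hk with
  | Int.ofNat n, _ => exact colPos_supp hT n j hj

theorem col_supp_neg (hT : ∀ k j : ℤ, k < 0 → 0 ≤ j → T (E k) j = 0) (k j : ℤ) (hk : k < 0)
    (hj : 0 ≤ j) : col T k j = 0 := by
  match k, hk with
  | Int.negSucc n, _ => exact colNeg_supp hT (n + 1) j hj

end column

theorem rel_of_basis {X : (ℤ →₀ ℂ) →ₗ[ℂ] L2Z} {a B : Op} (a' : (ℤ →₀ ℂ) →ₗ[ℂ] (ℤ →₀ ℂ))
    (h1 : ∀ k, fin (a' (Finsupp.single k 1)) = a (E k))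
    (h2 : ∀ k, B (E k) = X (a' (Finsupp.single k 1)) - a (X (Finsupp.single k 1))) :
    Rel X a B := by
  have e1 : fin ∘ₗ a' = (a : L2Z →ₗ[ℂ] L2Z) ∘ₗ fin := by
    ext k : 2
    simp only [LinearMap.comp_apply, Finsupp.lsingle_apply, h1, fin_single, one_smul]
    rfl
  have e2 : (B : L2Z →ₗ[ℂ] L2Z) ∘ₗ fin = X ∘ₗ a' - (a : L2Z →ₗ[ℂ] L2Z) ∘ₗ X := by
    ext k : 2
    simp only [LinearMap.comp_apply, LinearMap.sub_apply, Finsupp.lsingle_apply, fin_single,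
      one_smul]
    exact h2 k
  exact ⟨a', fun v => LinearMap.congr_fun e1 v, fun v => LinearMap.congr_fun e2 v⟩

theorem toeplitz_nonneg (f g : C(Circle, ℂ)) (k j : ℤ) (hk : 0 ≤ k) (hj : j < 0) :
    toeplitz f g (E k) j = 0 := by
  have h : PNeg (E k) = 0 := by
    ext i
    rw [PNeg_apply, E_apply]
    split_ifs <;> first | rfl | omega
  simp [toeplitz, h, not_le.2 hj]

theorem toeplitz_neg (f g : C(Circle, ℂ)) (k j : ℤ) (hk : k < 0) (hj : 0 ≤ j) :
    toeplitz f g (E k) j = 0 := by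
  have h : PNonneg (E k) = 0 := by
    ext i
    rw [PNonneg_apply, E_apply]
    split_ifs <;> first | rfl | omega
  simp [toeplitz, h, not_lt.2 hj]

theorem U_E (k : ℤ) : (U : Op) (E k) = E (k + 1) := by
  ext j
  rw [U_apply, E_apply, E_apply]
  exact if_congr (by omega) rfl rfl

theorem U_inv_E (k : ℤ) : ((U⁻¹ : unitary Op) : Op) (E k) = E (k - 1) := by
  ext j
  rw [U_inv_apply, E_apply, E_apply]
  exact if_congr (by omega) rfl rfl

theorem diag_E (a : BddSeq) (k : ℤ) : diag a (E k) = a k • E k := by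
  ext j
  rw [diag_apply, lp.coeFn_smul, Pi.smul_apply, E_apply]
  by_cases h : j = k
  · subst h; simp
  · simp [h]

theorem IsDerivation.map_one {D : polyAlg →ₗ[ℂ] cylinder} (h : IsDerivation D) : D 1 = 0 := by
  have e := h 1 1
  rw [mul_one, OneMemClass.coe_one, mul_one, one_mul] at e
  exact Subtype.ext (left_eq_add.1 e)

theorem IsBoundaryDerivation.map_U_inv {f g : C(Circle, ℂ)} {D : polyAlg →ₗ[ℂ] cylinder}
    (h : IsBoundaryDerivation f g D) :
    (D ⟨_, U_inv_mem_polyAlg⟩ : Op) = -(toeplitz f g * ((U⁻¹ : unitary Op) : Op)) := by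
  have e := h.isDerivation ⟨_, U_inv_mem_polyAlg⟩ ⟨_, U_mem_polyAlg⟩
  have e1 : (⟨_, U_inv_mem_polyAlg⟩ : polyAlg) * ⟨_, U_mem_polyAlg⟩ = 1 :=
    Subtype.ext U_inv_mul_U
  rw [e1, h.isDerivation.map_one, h.map_U, ← mul_assoc, U_inv_mul_U, one_mul] at e
  have e2 := congrArg (fun z : Op => z * ((U⁻¹ : unitary Op) : Op)) e
  simp only [ZeroMemClass.coe_zero, zero_mul, add_mul, mul_assoc, U_mul_U_inv, mul_one] at e2
  exact eq_neg_of_add_eq_zero_left e2.symm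

theorem IsBoundaryDerivation.unique {f g : C(Circle, ℂ)} {D D' : polyAlg →ₗ[ℂ] cylinder}
    (h : IsBoundaryDerivation f g D) (h' : IsBoundaryDerivation f g D') : D = D' := by
  have key : ∀ a ∈ Algebra.adjoin ℂ gens, ∃ ha : a ∈ polyAlg, D ⟨a, ha⟩ = D' ⟨a, ha⟩ := by
    intro a ha
    induction ha using Algebra.adjoin_induction with
    | mem x hx =>
      rcases hx with rfl | rfl | rfl | rfl
      · exact ⟨U_mem_polyAlg, Subtype.ext (h.map_U.trans h'.map_U.symm)⟩
      · exact ⟨U_inv_mem_polyAlg, Subtype.ext (h.map_U_inv.trans h'.map_U_inv.symm)⟩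
      · exact ⟨PNonneg_mem_polyAlg, h.map_PNonneg.trans h'.map_PNonneg.symm⟩
      · exact ⟨PZero_mem_polyAlg, h.map_PZero.trans h'.map_PZero.symm⟩
    | algebraMap c =>
      refine ⟨algebraMap_mem _ c, ?_⟩
      have e : (⟨algebraMap ℂ Op c, algebraMap_mem _ c⟩ : polyAlg) = c • 1 :=
        Subtype.ext (Algebra.algebraMap_eq_smul_one c)
      rw [e, map_smul, map_smul, h.isDerivation.map_one, h'.isDerivation.map_one]
    | add x y _ _ hx hy =>
      obtain ⟨hx, ex⟩ := hx
      obtain ⟨hy, ey⟩ := hy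
      refine ⟨add_mem hx hy, ?_⟩
      have e : (⟨x + y, add_mem hx hy⟩ : polyAlg) = ⟨x, hx⟩ + ⟨y, hy⟩ := rfl
      rw [e, map_add, map_add, ex, ey]
    | mul x y _ _ hx hy =>
      obtain ⟨hx, ex⟩ := hx
      obtain ⟨hy, ey⟩ := hy
      refine ⟨mul_mem hx hy, Subtype.ext ?_⟩
      have e : (⟨x * y, mul_mem hx hy⟩ : polyAlg) = ⟨x, hx⟩ * ⟨y, hy⟩ := rfl
      rw [e, h.isDerivation, h'.isDerivation, ex, ey]
  refine LinearMap.ext fun a => ?_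
  obtain ⟨_, e⟩ := key a (polyAlg_le_adjoin a.2)
  exact e

/-- There is exactly one derivation with the property defining `d_{f,g}`. -/
theorem existsUnique_boundaryDerivation (f g : C(Circle, ℂ)) :
    ∃! D : polyAlg →ₗ[ℂ] cylinder, IsBoundaryDerivation f g D := by
  set T := toeplitz f g with hT
  set X : (ℤ →₀ ℂ) →ₗ[ℂ] L2Z := Finsupp.linearCombination ℂ (col T) with hX
  have X1 : ∀ k, X (Finsupp.single k 1) = col T k := fun k => by simp [hX]
  have relU : Rel X U ((U : Op) * T) := by
    refine rel_of_basis (Finsupp.lmapDomain ℂ ℂ (· + 1)) (fun k => ?_) (fun k => ?_)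
    · simp [Finsupp.mapDomain_single, fin_single, U_E]
    · simp [Finsupp.mapDomain_single, X1, col_add_one]
  have relV : Rel X ((U⁻¹ : unitary Op) : Op) (-(T * ((U⁻¹ : unitary Op) : Op))) := by
    refine rel_of_basis (Finsupp.lmapDomain ℂ ℂ (· - 1)) (fun k => ?_) (fun k => ?_)
    · simp [Finsupp.mapDomain_single, fin_single, U_inv_E]
    · have h := col_add_one T (k - 1)
      rw [sub_add_cancel] at h
      have hV : ∀ x, ((U⁻¹ : unitary Op) : Op) ((U : Op) x) = x := fun x => by
        rw [← mul_apply_eq_comp, U_inv_mul_U, one_apply_eq_self]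
      simp only [_root_.neg_apply, mul_apply_eq_comp, Finsupp.lmapDomain_apply,
        Finsupp.mapDomain_single, X1, U_inv_E, h, hV]
      abel
  have relD : ∀ a : BddSeq, (∀ k j, (a k - a j) * col T k j = 0) → Rel X (diag a) 0 := by
    intro a ha
    refine rel_of_basis (Finsupp.lsum ℂ fun k => a k • Finsupp.lsingle k)
      (fun k => ?_) (fun k => ?_)
    · simp [fin_single, diag_E]
    · simp only [Finsupp.lsum_single, LinearMap.smul_apply, Finsupp.lsingle_apply, map_smul, X1]
      ext j
      have := ha k j
      simp only [_root_.zero_apply, lp.coeFn_zero, Pi.zero_apply, lp.coeFn_sub,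
        Pi.sub_apply, lp.coeFn_smul, Pi.smul_apply, smul_eq_mul, diag_apply]
      rw [← sub_mul, this]
  have s1 := fun k j => col_supp_nonneg (T := T) (toeplitz_nonneg f g) k j
  have s2 := fun k j => col_supp_neg (T := T) (toeplitz_neg f g) k j
  have relP : Rel X PNonneg 0 := relD _ fun k j => by
    simp only [indicatorSeq_apply]
    by_cases hk : 0 ≤ k <;> by_cases hj : 0 ≤ j <;> simp [hk, hj]
    · exact s1 k j hk (by omega)
    · exact s2 k j (by omega) hj
  have relZ : Rel X PZero 0 := relD _ fun k j => by
    simp only [indicatorSeq_apply]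
    by_cases hj : j = 0
    · by_cases hk : 0 ≤ k
      · rw [s1 k j hk (by omega), mul_zero]
      · rw [s2 k j (by omega) (by omega), mul_zero]
    · by_cases hk : k = 0
      · subst hk
        rw [show col T 0 j = 0 from rfl, mul_zero]
      · simp [hj, hk]
  have all : ∀ a ∈ polyAlg, ∃ B ∈ cylinder, Rel X a B := by
    intro a ha
    have hP : PNonneg ∈ cylinder := diag_mem_cylinder isEventuallyConstant_nonneg.isConvergent
    have hZ : PZero ∈ cylinder := diag_mem_cylinder isEventuallyConstant_zero.isConvergent
    have hTc : T ∈ cylinder := toeplitz_mem_cylinder f g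
    have ha' := polyAlg_le_adjoin ha
    suffices h : a ∈ cylinder ∧ ∃ B ∈ cylinder, Rel X a B from h.2
    clear ha
    induction ha' using Algebra.adjoin_induction with
    | mem x hx =>
      rcases hx with rfl | rfl | rfl | rfl
      · exact ⟨U_mem_cylinder, _, mul_mem U_mem_cylinder hTc, relU⟩
      · exact ⟨U_inv_mem_cylinder, _, neg_mem (mul_mem hTc U_inv_mem_cylinder), relV⟩
      · exact ⟨hP, 0, zero_mem _, relP⟩
      · exact ⟨hZ, 0, zero_mem _, relZ⟩
    | algebraMap c => exact ⟨algebraMap_mem _ c, 0, zero_mem _, Rel.algebraMap X c⟩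
    | add x y _ _ hx hy =>
      obtain ⟨hx, B, hB, hr⟩ := hx
      obtain ⟨hy, C, hC, hs⟩ := hy
      exact ⟨add_mem hx hy, _, add_mem hB hC, hr.add hs⟩
    | mul x y _ _ hx hy =>
      obtain ⟨hx, B, hB, hr⟩ := hx
      obtain ⟨hy, C, hC, hs⟩ := hy
      exact ⟨mul_mem hx hy, _, add_mem (mul_mem hB hy) (mul_mem hx hC), hr.mul hs⟩
  choose! F hF hR using all
  refine ⟨{ toFun := fun a => ⟨F a, hF a a.2⟩
            map_add' := fun a b => Subtype.ext
              ((hR _ (a + b).2).unique ((hR _ a.2).add (hR _ b.2)))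
            map_smul' := fun c a => Subtype.ext
              ((hR _ (c • a).2).unique ((hR _ a.2).smul c)) }, ?_, ?_⟩
  · exact ⟨fun a b => (hR _ (a * b).2).unique ((hR _ a.2).mul (hR _ b.2)),
      (hR _ U_mem_polyAlg).unique relU,
      Subtype.ext ((hR _ PNonneg_mem_polyAlg).unique relP),
      Subtype.ext ((hR _ PZero_mem_polyAlg).unique relZ)⟩
  · intro D hD
    exact hD.unique
      ⟨fun a b => (hR _ (a * b).2).unique ((hR _ a.2).mul (hR _ b.2)),
        (hR _ U_mem_polyAlg).unique relU,
        Subtype.ext ((hR _ PNonneg_mem_polyAlg).unique relP),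
        Subtype.ext ((hR _ PZero_mem_polyAlg).unique relZ)⟩

/-- The derivation `d_{f,g} : 𝒜 → A`: the unique derivation with `d_{f,g}(U) = U T_{f,g}` and
`d_{f,g}(P_{≥0}) = d_{f,g}(P₀) = 0`. -/
noncomputable def boundaryDerivation (f g : C(Circle, ℂ)) : polyAlg →ₗ[ℂ] cylinder :=
  (existsUnique_boundaryDerivation f g).choose

theorem boundaryDerivation_spec (f g : C(Circle, ℂ)) :
    IsBoundaryDerivation f g (boundaryDerivation f g) :=
  (existsUnique_boundaryDerivation f g).choose_spec.1

/-- `x` has boundary symbol `(p, q) ∈ C(S¹) ⊕ C(S¹)`: under `A/𝒦 ≅ C(S¹) ⊕ C(S¹)`, which sends the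
class of `T_{p,q}` to `(p, q)`, the class of `x` modulo the compact operators is `(p, q)`. -/
def HasBoundarySymbol (x : Op) (p q : C(Circle, ℂ)) : Prop :=
  IsCompactOperator (x - toeplitz p q)

/-- `p' = dp/dx`, where a function `p` on the circle is regarded as the function `x ↦ p(e^{ix})`. -/
def HasCircleDeriv (p p' : C(Circle, ℂ)) : Prop :=
  ∀ x : ℝ, HasDerivAt (fun t : ℝ => p (Circle.exp t)) (p' (Circle.exp x)) x

/-- `D` is a lift of `δ_{f,g} = (f (1/i) d/dx, g (1/i) d/dx)`, that is, `[D] = δ_{f,g}`: the boundary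
symbol `(p, q)` of `a ∈ 𝒜` is differentiable and the boundary symbol of `D(a)` is
`(f (1/i) dp/dx, g (1/i) dq/dx)`. -/
def LiftsBoundary (f g : C(Circle, ℂ)) (D : polyAlg →ₗ[ℂ] cylinder) : Prop :=
  ∀ a : polyAlg, ∃ p q p' q' : C(Circle, ℂ),
    HasBoundarySymbol (a : Op) p q ∧ HasCircleDeriv p p' ∧ HasCircleDeriv q q' ∧
    HasBoundarySymbol (D a : Op) (f * ((1 / Complex.I) • p')) (g * ((1 / Complex.I) • q'))

end QuantumCylinder

open Filter Topology

namespace QuantumCylinder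

open scoped ENNReal

/-! The compact operators enter through the condition `IsNegligible`, norm convergence of T·trunc N
to T, which is closed and passes through products and adjoints. Modulo such operators `PNonneg`
commutes with every f(U), so (f, g) ↦ `toeplitz f g` is multiplicative. Translating to +∞ or to -∞
recovers f(U) or g(U) from T_{f,g} plus a negligible operator, which makes the symbol unique and
norm decreasing (`norm_le_of_isNegligible`). Hence the operators with a symbol form a closed star
subalgebra containing the generators, and every element of `cylinder` has a symbol
(`exists_hasSymbol`). As symbols commute, all commutators in `cylinder` are negligible, and so are
all values of an approximately inner derivation.

Given a derivation d, the pair (f, g) is the symbol of U⁻¹d(U). This choice is forced: if d -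
d_{f,g} is approximately inner, its value at U is negligible, so U⁻¹d(U) - T_{f,g} is negligible.
Conversely, `IsDerivation.isApproximatelyInner_of_isNegligible` shows that a derivation D with D(U)
negligible is approximately inner. An inner derivation absorbs the values of D at the idempotents
P_{≥0} and P₀; the remainder has value U K at U, with K negligible and commuting with P_{≥0}. Finite
truncations of K are combinations of matrix units whose indices lie on the same side of 0, and for
these U K = [y, U] has an explicit solution y that commutes with both projections. The resulting y
approximate D on the generators, hence on the whole algebra.

For the lifting statement, the claim is compatible with sums and products by the Leibniz rule, so it
is enough to check it on the generators and scalars. -/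

/-! ### Strong convergence and finite truncations. -/

/-- The set on which a uniformly bounded sequence of additive maps converges to a bounded additive
map is closed. -/
theorem isClosed_setOf_tendsto_of_bound {V W : Type*} [SeminormedAddCommGroup V]
    [SeminormedAddCommGroup W] (A : ℕ → V →+ W) (B : V →+ W) (C : ℝ)
    (hA : ∀ n v, ‖A n v‖ ≤ C * ‖v‖) (hB : ∀ v, ‖B v‖ ≤ C * ‖v‖) :
    IsClosed {v | Tendsto (fun n => A n v) atTop (𝓝 (B v))} := by
  have hE : Equicontinuous fun n => (A n : V → W) := by
    refine (LipschitzWith.uniformEquicontinuous (fun n => (A n : V → W)) C.toNNReal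
      fun n => ?_).equicontinuous
    refine AddMonoidHomClass.lipschitz_of_bound (A n) C (hA n)
  exact hE.isClosed_setOfPred_tendsto (AddMonoidHomClass.lipschitz_of_bound B C hB).continuous

theorem diag_norm_le {a : BddSeq} {C : ℝ} (hC : 0 ≤ C) (h : ∀ k, ‖a k‖ ≤ C) : ‖diag a‖ ≤ C :=
  (lp.norm_mapCLM_le (p := 2) _ (norm_nonneg a) _).trans (lp.norm_le_of_forall_le hC h)

theorem diag_mul (a b : BddSeq) : diag a * diag b = diag (a * b) :=
  op_ext fun f k => by simp [mul_apply_eq_comp, lp.infty_coeFn_mul, mul_assoc]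

theorem inner_E (k : ℤ) (f : L2Z) : inner ℂ (E k) f = f k := by
  simp [E, lp.inner_single_left]

theorem star_apply (T : Op) (j k : ℤ) : (star T) (E j) k = star (T (E k) j) := by
  rw [← inner_E, ContinuousLinearMap.star_eq_adjoint, ContinuousLinearMap.adjoint_inner_right,
    ← inner_E j]
  exact (inner_conj_symm _ _).symm

theorem op_ext_E {S T : Op} (h : ∀ j k, S (E j) k = T (E j) k) : S = T := by
  refine lp.ext_continuousLinearMap (by norm_num) fun i => ?_
  ext1
  exact lp.ext (funext (h i))

theorem star_diag (a : BddSeq) : star (diag a) = diag (star a) := by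
  refine op_ext_E fun j k => ?_
  rw [star_apply, diag_E, diag_E]
  by_cases h : j = k
  · subst h; simp [lp.coeFn_smul, E_apply, lp.star_apply]
  · simp [lp.coeFn_smul, E_apply, h, Ne.symm h]

/-- The orthogonal projection onto the span of `E_k`, `-N ≤ k < N`. -/
noncomputable def trunc (N : ℕ) : Op := diag (indicatorSeq fun k => -(N : ℤ) ≤ k ∧ k < N)

@[simp] theorem trunc_apply (N : ℕ) (f : L2Z) (k : ℤ) :
    trunc N f k = if -(N : ℤ) ≤ k ∧ k < N then f k else 0 := by
  simp [trunc]

theorem norm_trunc_le (N : ℕ) : ‖trunc N‖ ≤ 1 :=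
  diag_norm_le zero_le_one fun k => by rw [indicatorSeq_apply]; split_ifs <;> simp

theorem star_trunc (N : ℕ) : star (trunc N) = trunc N := by
  rw [trunc, star_diag]
  congr 1
  refine lp.ext (funext fun k => ?_)
  rw [lp.star_apply, indicatorSeq_apply]
  split_ifs <;> simp

theorem norm_E (k : ℤ) : ‖E k‖ = 1 := by
  rw [E, lp.norm_single (by norm_num)]; simp

theorem trunc_E_of_mem {N : ℕ} {k : ℤ} (h : -(N : ℤ) ≤ k ∧ k < N) : trunc N (E k) = E k := by
  rw [trunc, diag_E, indicatorSeq_apply, if_pos h, one_smul]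

theorem eventually_mem_window (k : ℤ) : ∀ᶠ N : ℕ in atTop, -(N : ℤ) ≤ k ∧ k < N := by
  filter_upwards [eventually_ge_atTop (k.natAbs + 1)] with N hN
  omega

/-- A uniformly bounded sequence of operators that converges on the canonical basis converges
strongly. -/
theorem tendsto_of_tendsto_E (A : ℕ → Op) (B : Op) (C : ℝ) (hA : ∀ n, ‖A n‖ ≤ C) (hB : ‖B‖ ≤ C)
    (h : ∀ k, Tendsto (fun n => A n (E k)) atTop (𝓝 (B (E k)))) (v : L2Z) :
    Tendsto (fun n => A n v) atTop (𝓝 (B v)) := by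
  have hcl := isClosed_setOf_tendsto_of_bound (fun n => ((A n : L2Z →ₗ[ℂ] L2Z).toAddMonoidHom))
    ((B : L2Z →ₗ[ℂ] L2Z).toAddMonoidHom) C (fun n v => (A n).le_of_opNorm_le (hA n) v)
    (fun v => B.le_of_opNorm_le hB v)
  have hs := lp.hasSum_single (by norm_num) v
  refine hcl.mem_of_tendsto hs (Eventually.of_forall fun s => ?_)
  have e : ∀ S : Op, S (∑ i ∈ s, lp.single 2 i (v i)) = ∑ i ∈ s, v i • S (E i) := fun S => by
    rw [map_sum]
    refine Finset.sum_congr rfl fun i _ => ?_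
    rw [← map_smul, E, ← lp.single_smul, smul_eq_mul, mul_one]
  change Tendsto (fun n => A n _) atTop (𝓝 (B _))
  simp only [e]
  exact tendsto_finsetSum _ fun i _ => (h i).const_smul _

theorem tendsto_trunc (v : L2Z) : Tendsto (fun N => trunc N v) atTop (𝓝 v) := by
  refine tendsto_of_tendsto_E trunc 1 1 norm_trunc_le ContinuousLinearMap.norm_id_le (fun k => ?_) v
  refine tendsto_const_nhds.congr' ((eventually_mem_window k).mono fun N h => ?_)
  exact (trunc_E_of_mem h).symm

/-! ### Negligible operators. -/

/-- The operators that are norm limits of their restrictions to finitely many basis vectors; these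
are the compact operators. -/
def IsNegligible (T : Op) : Prop := Tendsto (fun N => T * trunc N) atTop (𝓝 T)

theorem norm_mul_trunc_le (T : Op) (N : ℕ) : ‖T * trunc N‖ ≤ ‖T‖ :=
  (norm_mul_le _ _).trans (mul_le_of_le_one_right (norm_nonneg _) (norm_trunc_le N))

theorem norm_trunc_mul_le (T : Op) (N : ℕ) : ‖trunc N * T‖ ≤ ‖T‖ :=
  (norm_mul_le _ _).trans (mul_le_of_le_one_left (norm_nonneg _) (norm_trunc_le N))

theorem isClosed_isNegligible : IsClosed {T | IsNegligible T} :=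
  isClosed_setOf_tendsto_of_bound (fun N => AddMonoidHom.mulRight (trunc N)) (.id Op) 1
    (fun N T => by simpa using norm_mul_trunc_le T N) (fun T => by simp)

theorem IsNegligible.zero : IsNegligible 0 := by simp [IsNegligible]

theorem IsNegligible.add {S T : Op} (hS : IsNegligible S) (hT : IsNegligible T) :
    IsNegligible (S + T) := by
  simpa only [IsNegligible, add_mul] using Tendsto.add hS hT

theorem IsNegligible.smul {T : Op} (hT : IsNegligible T) (c : ℂ) : IsNegligible (c • T) := by
  simpa only [IsNegligible, smul_mul_assoc] using Tendsto.const_smul hT c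

theorem IsNegligible.neg {T : Op} (hT : IsNegligible T) : IsNegligible (-T) := by
  simpa using hT.smul (-1)

theorem IsNegligible.sub {S T : Op} (hS : IsNegligible S) (hT : IsNegligible T) :
    IsNegligible (S - T) := by
  simpa only [sub_eq_add_neg] using hS.add hT.neg

theorem IsNegligible.mul_left {T : Op} (hT : IsNegligible T) (S : Op) : IsNegligible (S * T) := by
  simpa only [IsNegligible, mul_assoc] using Tendsto.const_mul S hT

/-- The matrix unit that sends `E_j` to `E_i`. -/
noncomputable def matrixUnit (i j : ℤ) : Op :=
  ((U ^ i : unitary Op) : Op) * PZero * ((U ^ (-j) : unitary Op) : Op)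

theorem matrixUnit_apply (i j : ℤ) (f : L2Z) : matrixUnit i j f = f j • E i := by
  ext k
  simp only [matrixUnit, mul_apply_eq_comp, U_zpow_apply, PZero_apply, lp.coeFn_smul,
    Pi.smul_apply, E_apply, smul_eq_mul, sub_eq_zero]
  split_ifs with h
  · subst h; simp
  · simp

/-- The product has rank at most one, with f ↦ f j · T (E i). This turns strong convergence at one
basis vector into norm convergence. -/
theorem norm_mul_matrixUnit_le (T : Op) (i j : ℤ) : ‖T * matrixUnit i j‖ ≤ ‖T (E i)‖ := by
  refine ContinuousLinearMap.opNorm_le_bound _ (norm_nonneg _) fun f => ?_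
  rw [mul_apply_eq_comp, matrixUnit_apply, map_smul, norm_smul, mul_comm]
  exact mul_le_mul_of_nonneg_left (lp.norm_apply_le_norm (by norm_num) f j) (norm_nonneg _)

theorem trunc_eq_sum (N : ℕ) : trunc N = ∑ j ∈ Finset.Ico (-(N : ℤ)) N, matrixUnit j j := by
  refine op_ext fun f k => ?_
  rw [trunc_apply, _root_.sum_apply, lp.coeFn_sum, Finset.sum_apply]
  simp [matrixUnit_apply, E_apply]

/-- The conclusion is a closed condition on T, and T is a limit of the operators T * trunc M. These
are finite sums of operators of rank at most one, on which strong convergence of the truncations is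
already norm convergence. Together with adjoints, this makes negligibility stable under right
multiplication. -/
theorem IsNegligible.tendsto_trunc_mul {T : Op} (hT : IsNegligible T) :
    Tendsto (fun N => trunc N * T) atTop (𝓝 T) := by
  have hcl : IsClosed {T : Op | Tendsto (fun N => trunc N * T) atTop (𝓝 T)} :=
    isClosed_setOf_tendsto_of_bound (fun N => AddMonoidHom.mulLeft (trunc N)) (.id Op) 1
      (fun N T => by simpa using norm_trunc_mul_le T N) (fun T => by simp)
  refine hcl.mem_of_tendsto hT (Eventually.of_forall fun M => ?_)
  change Tendsto (fun N => trunc N * (T * trunc M)) atTop (𝓝 (T * trunc M))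
  simp only [trunc_eq_sum M, Finset.mul_sum]
  refine tendsto_finsetSum _ fun j _ => ?_
  rw [tendsto_iff_norm_sub_tendsto_zero]
  refine squeeze_zero (fun _ => norm_nonneg _) (fun N => ?_)
    (tendsto_iff_norm_sub_tendsto_zero.1 (tendsto_trunc (T (E j))))
  have := norm_mul_matrixUnit_le (trunc N * T - T) j j
  rwa [sub_mul, mul_assoc] at this

theorem isNegligible_star_of_tendsto {T : Op} (h : Tendsto (fun N => trunc N * T) atTop (𝓝 T)) :
    IsNegligible (star T) := by
  simpa only [IsNegligible, star_mul, star_trunc] using h.star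

theorem IsNegligible.star {T : Op} (hT : IsNegligible T) : IsNegligible (star T) :=
  isNegligible_star_of_tendsto hT.tendsto_trunc_mul

theorem IsNegligible.mul_right {T : Op} (hT : IsNegligible T) (S : Op) : IsNegligible (T * S) := by
  simpa using (hT.star.mul_left (Star.star S)).star

theorem IsNegligible.tendsto_trunc_mul_trunc {T : Op} (hT : IsNegligible T) :
    Tendsto (fun N => trunc N * T * trunc N) atTop (𝓝 T) := by
  -- Uses trunc·T·trunc = trunc·(T·trunc - T) + trunc·T; the first term is controlled by the
  -- contractivity of the truncations.
  have h1 : Tendsto (fun N => trunc N * (T * trunc N - T)) atTop (𝓝 0) := by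
    refine squeeze_zero_norm (fun N => norm_trunc_mul_le _ N)
      (tendsto_iff_norm_sub_tendsto_zero.1 hT)
  have := h1.add hT.tendsto_trunc_mul
  rw [zero_add] at this
  exact this.congr fun N => by noncomm_ring

theorem isCompactOperator_matrixUnit (i j : ℤ) : IsCompactOperator (matrixUnit i j) := by
  refine ⟨(fun c : ℂ => c • E i) '' Metric.closedBall 0 1,
    (isCompact_closedBall 0 1).image (by fun_prop), ?_⟩
  filter_upwards [Metric.closedBall_mem_nhds (0 : L2Z) one_pos] with f hf
  refine ⟨f j, ?_, (matrixUnit_apply i j f).symm⟩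
  rw [mem_closedBall_zero_iff] at hf ⊢
  exact (lp.norm_apply_le_norm (by norm_num) f j).trans hf

theorem IsNegligible.isCompactOperator {T : Op} (hT : IsNegligible T) : IsCompactOperator T := by
  refine isClosed_setOfPred_isCompactOperator.mem_of_tendsto hT (Eventually.of_forall fun N => ?_)
  change T * trunc N ∈ compactOperator (RingHom.id ℂ) L2Z L2Z
  rw [trunc_eq_sum, Finset.mul_sum]
  exact sum_mem fun j _ => (isCompactOperator_matrixUnit j j).clm_comp T

theorem isNegligible_diag {a : BddSeq} (h1 : Tendsto (fun k : ℤ => a k) atTop (𝓝 0))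
    (h2 : Tendsto (fun k : ℤ => a k) atBot (𝓝 0)) : IsNegligible (diag a) := by
  rw [IsNegligible, Metric.tendsto_atTop]
  intro ε hε
  obtain ⟨N, hN⟩ := eventually_atTop.1 (h1.eventually (Metric.ball_mem_nhds 0 (half_pos hε)))
  obtain ⟨M, hM⟩ := eventually_atBot.1 (h2.eventually (Metric.ball_mem_nhds 0 (half_pos hε)))
  -- Every index outside this window is at least N or at most M, where the entries of `a` are
  -- smaller than ε/2.
  refine ⟨N.natAbs + M.natAbs, fun n hn => ?_⟩
  rw [dist_comm, dist_eq_norm]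
  have e : diag a - diag a * trunc n =
      diag (a - a * indicatorSeq fun k => -(n : ℤ) ≤ k ∧ k < n) :=
    op_ext fun f k => by
      simp only [_root_.sub_apply, trunc, diag_mul, lp.coeFn_sub, Pi.sub_apply, diag_apply, sub_mul]
  rw [e]
  refine (diag_norm_le (half_pos hε).le fun k => ?_).trans_lt (half_lt_self hε)
  rw [lp.coeFn_sub, Pi.sub_apply, lp.infty_coeFn_mul, Pi.mul_apply, indicatorSeq_apply]
  split_ifs with h
  · simpa using (half_pos hε).le
  · rw [mul_zero, sub_zero]
    rcases le_or_gt N k with hk | hk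
    · simpa using (mem_ball_zero_iff.1 (hN k hk)).le
    · exact (mem_ball_zero_iff.1 (hM k (by omega))).le

/-! ### Continuous functional calculus of the bilateral shift. -/

theorem spectrum_U_subset : spectrum ℂ (U : Op) ⊆ Metric.sphere 0 1 :=
  spectrum.subset_circle_of_unitary U.2

/-- The extension by `0` of a function on the circle to the plane. -/
noncomputable def circleExtend (f : C(Circle, ℂ)) : ℂ → ℂ :=
  Function.extend ((↑) : Circle → ℂ) f 0

theorem circleExtend_coe (f : C(Circle, ℂ)) (z : Circle) : circleExtend f (z : ℂ) = f z :=
  Circle.coe_injective.extend_apply f 0 z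

theorem circleFun_eq (f : C(Circle, ℂ)) : circleFun f = cfc (circleExtend f) (U : Op) := rfl

theorem exists_circle_of_mem_spectrum {z : ℂ} (hz : z ∈ spectrum ℂ (U : Op)) :
    ∃ w : Circle, (w : ℂ) = z :=
  ⟨⟨z, spectrum_U_subset hz⟩, rfl⟩

theorem continuousOn_circleExtend (f : C(Circle, ℂ)) :
    ContinuousOn (circleExtend f) (spectrum ℂ (U : Op)) := by
  refine ContinuousOn.mono ?_ spectrum_U_subset
  rw [continuousOn_iff_continuous_domRestrict]
  exact f.continuous.congr fun z => (circleExtend_coe f z).symm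

theorem circleFun_of_forall (f : C(Circle, ℂ)) (F : ℂ → ℂ) (h : ∀ z : Circle, F z = f z) :
    circleFun f = cfc F (U : Op) := by
  refine cfc_congr fun z hz => ?_
  obtain ⟨w, rfl⟩ := exists_circle_of_mem_spectrum hz
  exact (circleExtend_coe f w).trans (h w).symm

theorem isStarNormal_U : IsStarNormal (U : Op) :=
  ⟨(Unitary.star_mul_self_of_mem U.2).trans (Unitary.mul_star_self_of_mem U.2).symm⟩

theorem circleFun_add (f g : C(Circle, ℂ)) : circleFun (f + g) = circleFun f + circleFun g := by
  rw [circleFun_eq f, circleFun_eq g,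
    ← cfc_add _ _ _ (continuousOn_circleExtend f) (continuousOn_circleExtend g)]
  exact circleFun_of_forall _ _ fun z => by simp [circleExtend_coe]

theorem circleFun_mul (f g : C(Circle, ℂ)) : circleFun (f * g) = circleFun f * circleFun g := by
  rw [circleFun_eq f, circleFun_eq g,
    ← cfc_mul _ _ _ (continuousOn_circleExtend f) (continuousOn_circleExtend g)]
  exact circleFun_of_forall _ _ fun z => by simp [circleExtend_coe]

theorem circleFun_smul (c : ℂ) (f : C(Circle, ℂ)) : circleFun (c • f) = c • circleFun f := by
  rw [circleFun_eq f, ← cfc_smul c _ _ (continuousOn_circleExtend f)]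
  exact circleFun_of_forall _ _ fun z => by simp [circleExtend_coe]

theorem circleFun_star (f : C(Circle, ℂ)) : circleFun (star f) = star (circleFun f) := by
  rw [circleFun_eq f, ← cfc_star]
  exact circleFun_of_forall _ _ fun z => by simp [circleExtend_coe]

theorem circleFun_one : circleFun 1 = 1 := by
  rw [circleFun_of_forall 1 (fun _ => 1) fun z => rfl]
  exact cfc_const_one ℂ (U : Op) isStarNormal_U

/-- The coordinate function `z = e^{ix}` on the circle. -/
noncomputable def circleCoord : C(Circle, ℂ) := ⟨(↑), continuous_subtype_val⟩

theorem circleFun_coord : circleFun circleCoord = U := by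
  rw [circleFun_of_forall circleCoord (fun z => z) fun z => rfl]
  exact cfc_id' ℂ (U : Op) isStarNormal_U

theorem star_U : star (U : Op) = ((U⁻¹ : unitary Op) : Op) := rfl

theorem circleFun_star_coord : circleFun (star circleCoord) = ((U⁻¹ : unitary Op) : Op) := by
  rw [circleFun_star, circleFun_coord, star_U]

/-- The bounded function `k ↦ w ^ k`. -/
noncomputable def phaseSeq (w : Circle) : BddSeq :=
  ⟨fun k => ((w ^ k : Circle) : ℂ), memℓp_infty ⟨1, by rintro _ ⟨k, rfl⟩; exact (Circle.norm_coe _).le⟩⟩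

theorem phaseSeq_apply (w : Circle) (k : ℤ) : phaseSeq w k = ((w ^ k : Circle) : ℂ) := rfl

theorem diag_phaseSeq_mul (w : Circle) : diag (phaseSeq w) * diag (phaseSeq w⁻¹) = 1 :=
  op_ext fun f k => by
    simp only [mul_apply_eq_comp, diag_apply, phaseSeq_apply, ← mul_assoc, ← Circle.coe_mul,
      inv_zpow, mul_inv_cancel, Circle.coe_one, one_mul, one_apply_eq_self]

/-- The diagonal unitary `k ↦ w ^ k`, as a unit. -/
noncomputable def phaseUnit (w : Circle) : Opˣ :=
  ⟨diag (phaseSeq w), diag (phaseSeq w⁻¹), diag_phaseSeq_mul w, by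
    simpa using diag_phaseSeq_mul w⁻¹⟩

/-- Rotation symmetry of the shift: its spectrum is invariant under multiplication by unimodular
numbers. -/
theorem phase_conj_U (w : Circle) :
    (phaseUnit w : Op) * (U : Op) * ((phaseUnit w)⁻¹ : Opˣ) = (w : ℂ) • (U : Op) := by
  refine op_ext fun f k => ?_
  change phaseSeq w k * (phaseSeq w⁻¹ (k - 1) * f (k - 1)) = (w : ℂ) * f (k - 1)
  rw [← mul_assoc, phaseSeq_apply, phaseSeq_apply, ← Circle.coe_mul, inv_zpow, ← zpow_neg,
    ← zpow_add, show k + -(k - 1) = 1 by ring, zpow_one]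

instance : Nontrivial Op :=
  ⟨1, 0, fun h => by
    have := congrArg (fun T : Op => ‖T (E 0)‖) h
    simp [norm_E] at this⟩

/-- The spectrum of the bilateral shift is the whole unit circle. -/
theorem mem_spectrum_U (z : Circle) : (z : ℂ) ∈ spectrum ℂ (U : Op) := by
  obtain ⟨_, hv⟩ := spectrum.nonempty (U : Op)
  obtain ⟨v, rfl⟩ := exists_circle_of_mem_spectrum hv
  -- The spectrum contains some v on the circle; the rotation by z v⁻¹ carries v to z.
  have e := spectrum.units_conjugate (R := ℂ) (a := (U : Op)) (u := phaseUnit (z * v⁻¹))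
  rw [phase_conj_U] at e
  rw [← e, show ((z * v⁻¹ : Circle) : ℂ) • (U : Op) = Circle.toUnits (z * v⁻¹) • (U : Op) from rfl,
    spectrum.unit_smul_eq_smul]
  refine ⟨_, hv, ?_⟩
  change ((z * v⁻¹ : Circle) : ℂ) * (v : ℂ) = z
  rw [← Circle.coe_mul, inv_mul_cancel_right]

/-- The lower bound needs the spectrum to fill the circle; otherwise only the supremum over the
spectrum would be seen. -/
theorem norm_circleFun (f : C(Circle, ℂ)) : ‖circleFun f‖ = ‖f‖ := by
  rw [circleFun_eq]
  refine le_antisymm (norm_cfc_le (norm_nonneg f) fun z hz => ?_)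
    ((ContinuousMap.norm_le _ (norm_nonneg _)).2 fun z => ?_)
  · obtain ⟨w, rfl⟩ := exists_circle_of_mem_spectrum hz
    rw [circleExtend_coe]
    exact f.norm_coe_le_norm w
  · have h := norm_apply_le_norm_cfc (circleExtend f) (U : Op) (mem_spectrum_U z)
      (continuousOn_circleExtend f) isStarNormal_U
    rwa [circleExtend_coe] at h

/-! ### Toeplitz operators modulo negligible operators. -/

theorem PNonneg_add_PNeg : PNonneg + PNeg = 1 :=
  op_ext fun f k => by
    simp only [_root_.add_apply, lp.coeFn_add, Pi.add_apply, PNonneg_apply, PNeg_apply,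
      one_apply_eq_self]
    split_ifs <;> first | omega | simp

theorem PNeg_eq : PNeg = 1 - PNonneg := eq_sub_of_add_eq' PNonneg_add_PNeg

theorem PNonneg_mul_self : PNonneg * PNonneg = PNonneg :=
  op_ext fun f k => by
    simp only [mul_apply_eq_comp, PNonneg_apply]
    split_ifs <;> rfl

theorem PNonneg_mul_PNeg : PNonneg * PNeg = 0 := by
  rw [PNeg_eq, mul_sub, mul_one, PNonneg_mul_self, sub_self]

theorem PNeg_mul_self : PNeg * PNeg = PNeg := by
  nth_rw 1 [PNeg_eq]
  rw [sub_mul, one_mul, PNonneg_mul_PNeg, sub_zero]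

theorem star_PNonneg : star PNonneg = PNonneg := by
  rw [PNonneg, star_diag]
  congr 1
  refine lp.ext (funext fun k => ?_)
  rw [lp.star_apply, indicatorSeq_apply]
  split_ifs <;> simp

theorem star_PNeg : star PNeg = PNeg := by
  rw [PNeg_eq, star_sub, star_one, star_PNonneg]

theorem norm_PNonneg_le : ‖PNonneg‖ ≤ 1 :=
  diag_norm_le zero_le_one fun k => by rw [indicatorSeq_apply]; split_ifs <;> simp

theorem norm_PNeg_le : ‖PNeg‖ ≤ 1 :=
  diag_norm_le zero_le_one fun k => by rw [indicatorSeq_apply]; split_ifs <;> simp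

theorem isNegligible_PZero : IsNegligible PZero := by
  refine tendsto_const_nhds.congr' ((eventually_ge_atTop 1).mono fun M hM => ?_)
  refine op_ext fun f k => ?_
  simp only [mul_apply_eq_comp, trunc_apply, PZero_apply]
  split_ifs <;> first | rfl | omega

theorem U_mul_PNonneg : (U : Op) * PNonneg = (PNonneg - PZero) * U :=
  op_ext fun f k => by
    simp only [mul_apply_eq_comp, U_apply, PNonneg_apply, PZero_apply, _root_.sub_apply,
      lp.coeFn_sub, Pi.sub_apply]
    split_ifs <;> first | omega | simp

/-- `P_{≥0}` commutes with the functions of `U` up to negligible operators. -/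
theorem isNegligible_commutator_circleFun (f : C(Circle, ℂ)) :
    IsNegligible (PNonneg * circleFun f - circleFun f * PNonneg) := by
  -- The operators commuting with P_{≥0} up to negligible ones form a closed star subalgebra, so
  -- membership of U carries over to all f(U). For U itself the commutator is P₀U.
  let S : StarSubalgebra ℂ Op :=
    { carrier := {T | IsNegligible (PNonneg * T - T * PNonneg)}
      mul_mem' := fun {a b} ha hb => by
        have := (ha.mul_right b).add (hb.mul_left a)
        change IsNegligible _
        convert this using 1
        noncomm_ring
      add_mem' := fun {a b} ha hb => by
        change IsNegligible _
        convert ha.add hb using 1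
        noncomm_ring
      algebraMap_mem' := fun c => by
        change IsNegligible _
        rw [← Algebra.commutes, sub_self]
        exact IsNegligible.zero
      star_mem' := fun {a} ha => by
        change IsNegligible _
        convert ha.star.neg using 1
        rw [star_sub, star_mul, star_mul, star_PNonneg, neg_sub] }
  have hcl : IsClosed (S : Set Op) :=
    isClosed_isNegligible.preimage (f := fun T : Op => PNonneg * T - T * PNonneg) (by fun_prop)
  have hU : (U : Op) ∈ S := by
    change IsNegligible _
    rw [U_mul_PNonneg, sub_mul, sub_sub_cancel]
    exact isNegligible_PZero.mul_right _
  exact cfc_mem (𝕜 := ℂ) (𝕜' := ℂ) (s := S) _ hU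

theorem toeplitz_add (f g f' g' : C(Circle, ℂ)) :
    toeplitz (f + f') (g + g') = toeplitz f g + toeplitz f' g' := by
  simp only [toeplitz, circleFun_add]
  noncomm_ring

theorem toeplitz_smul (c : ℂ) (f g : C(Circle, ℂ)) :
    toeplitz (c • f) (c • g) = c • toeplitz f g := by
  simp only [toeplitz, circleFun_smul, mul_smul_comm, smul_mul_assoc, smul_add]

theorem toeplitz_neg_neg (f g : C(Circle, ℂ)) : toeplitz (-f) (-g) = -toeplitz f g := by
  simpa using toeplitz_smul (-1) f g

theorem toeplitz_sub (f g f' g' : C(Circle, ℂ)) :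
    toeplitz (f - f') (g - g') = toeplitz f g - toeplitz f' g' := by
  rw [sub_eq_add_neg f, sub_eq_add_neg g, toeplitz_add, toeplitz_neg_neg, ← sub_eq_add_neg]

theorem star_toeplitz (f g : C(Circle, ℂ)) : star (toeplitz f g) = toeplitz (star f) (star g) := by
  simp only [toeplitz, circleFun_star, star_add, star_mul, star_PNonneg, star_PNeg, mul_assoc]

theorem toeplitz_const (r s : ℂ) :
    toeplitz (r • 1) (s • 1) = r • PNonneg + s • PNeg := by
  simp only [toeplitz, circleFun_smul, circleFun_one, mul_smul_comm, smul_mul_assoc, mul_one,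
    PNonneg_mul_self, PNeg_mul_self]

/-- `T_{f,g}` is multiplicative in `(f, g)` up to negligible operators. -/
theorem isNegligible_toeplitz_mul (f g f' g' : C(Circle, ℂ)) :
    IsNegligible (toeplitz f g * toeplitz f' g' - toeplitz (f * f') (g * g')) := by
  -- With P = P_{≥0} and Q = 1 - P, the defect of the P-corner is -P f(U) Q f'(U) P, and P f(U) Q =
  -- P [P, f(U)] Q. The Q-corner is similar, with Q g(U) P = -Q [P, g(U)] P; hence the opposite
  -- signs of `h1` and `h2`.
  have h1 := ((isNegligible_commutator_circleFun f).mul_left PNonneg).mul_right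
    (PNeg * circleFun f' * PNonneg)
  have h2 := ((isNegligible_commutator_circleFun g).mul_left PNeg).mul_right
    (PNonneg * circleFun g' * PNeg)
  convert h2.sub h1 using 1
  simp only [toeplitz, circleFun_mul]
  generalize circleFun f = a
  generalize circleFun f' = b
  generalize circleFun g = c
  generalize circleFun g' = d
  have hP := PNonneg_mul_self
  rw [PNeg_eq]
  generalize PNonneg = p at *
  have e : ∀ x : Op, p * (p * x) = p * x := fun x => by rw [← mul_assoc, hP]
  simp only [mul_add, add_mul, mul_sub, sub_mul, mul_one, one_mul, mul_assoc, e]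
  abel

/-! ### Recovering the symbol at the two ends of ℤ. -/

/-- K is norm close to K * trunc m, which kills every basis vector outside the window. Here `hc`
says that the indices eventually leave each window. -/
theorem tendsto_apply_E {K : Op} (hK : IsNegligible K) (c : ℕ → ℤ)
    (hc : ∀ m : ℕ, ∀ᶠ n in atTop, ¬ (-(m : ℤ) ≤ c n ∧ c n < m)) :
    Tendsto (fun n => K (E (c n))) atTop (𝓝 0) := by
  rw [Metric.tendsto_nhds]
  intro ε hε
  obtain ⟨m, hm⟩ := (Metric.tendsto_nhds.1 hK ε hε).exists
  filter_upwards [hc m] with n hn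
  have e : trunc m (E (c n)) = 0 := by
    rw [trunc, diag_E, indicatorSeq_apply, if_neg hn, zero_smul]
  have h := (K * trunc m - K).le_opNorm (E (c n))
  rw [norm_E, mul_one, _root_.sub_apply, mul_apply_eq_comp, e, map_zero, zero_sub, norm_neg] at h
  rw [dist_eq_norm] at hm
  rw [dist_zero_right]
  exact h.trans_lt hm

theorem U_zpow_E (n k : ℤ) : ((U ^ n : unitary Op) : Op) (E k) = E (k + n) := by
  ext j
  rw [U_zpow_apply, E_apply, E_apply]
  exact if_congr (by omega) rfl rfl

theorem norm_zpow_apply (n : ℤ) (v : L2Z) : ‖((U ^ n : unitary Op) : Op) v‖ = ‖v‖ :=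
  ContinuousLinearMap.norm_map_of_mem_unitary (U ^ n : unitary Op).2 v

theorem norm_zpow_le (n : ℤ) : ‖((U ^ n : unitary Op) : Op)‖ ≤ 1 :=
  ContinuousLinearMap.opNorm_le_bound _ zero_le_one fun v => by rw [norm_zpow_apply, one_mul]

/-- Integer powers of U are themselves functions of U, and functions of U commute. -/
theorem circleFun_comm_zpow (f : C(Circle, ℂ)) (n : ℤ) :
    circleFun f * ((U ^ n : unitary Op) : Op) = ((U ^ n : unitary Op) : Op) * circleFun f := by
  have h : ∀ z : ℤ, ∃ g, ((U ^ z : unitary Op) : Op) = circleFun g := fun z => by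
    induction z using Int.induction_on with
    | zero => exact ⟨1, by rw [circleFun_one]; simp⟩
    | succ n ih =>
      obtain ⟨g, hg⟩ := ih
      exact ⟨g * circleCoord, by rw [zpow_add, zpow_one, Submonoid.coe_mul, hg, circleFun_mul,
        circleFun_coord]⟩
    | pred n ih =>
      obtain ⟨g, hg⟩ := ih
      exact ⟨g * star circleCoord, by rw [sub_eq_add_neg, zpow_add, zpow_neg_one,
        Submonoid.coe_mul, hg, circleFun_mul, circleFun_star_coord]⟩
  obtain ⟨g, hg⟩ := h n
  rw [hg, ← circleFun_mul, ← circleFun_mul, mul_comm]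

/-- If `f(U)` and `T` differ by an operator that vanishes asymptotically along the shifts by
`c n`, then `f` is bounded by the norm of `T`. -/
theorem norm_le_of_asymptotic {f : C(Circle, ℂ)} {T Q X K : Op} {c : ℕ → ℤ}
    (hR : circleFun f - T = Q * circleFun f + X * Q + K)
    (hQ : ∀ k, Tendsto (fun n => Q (E (k + c n))) atTop (𝓝 0))
    (hK : ∀ k, Tendsto (fun n => K (E (k + c n))) atTop (𝓝 0)) :
    ‖f‖ ≤ ‖T‖ := by
  have bound : ∀ (S : Op) (C : ℝ), ‖S‖ ≤ C → ∀ n : ℤ, ‖S * ((U ^ n : unitary Op) : Op)‖ ≤ C :=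
    fun S C h n => (norm_mul_le _ _).trans
      ((mul_le_of_le_one_right (norm_nonneg _) (norm_zpow_le n)).trans h)
  have strong : ∀ S : Op, (∀ k, Tendsto (fun n => S (E (k + c n))) atTop (𝓝 0)) → ∀ v,
      Tendsto (fun n => S (((U ^ c n : unitary Op) : Op) v)) atTop (𝓝 0) := fun S h v => by
    refine tendsto_of_tendsto_E (fun n => S * ((U ^ c n : unitary Op) : Op)) 0 ‖S‖
      (fun n => bound S _ le_rfl _) (by simp) (fun k => ?_) v
    simpa only [mul_apply_eq_comp, U_zpow_E, _root_.zero_apply] using h k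
  have hRv : ∀ v, Tendsto (fun n => (circleFun f - T) (((U ^ c n : unitary Op) : Op) v)) atTop
      (𝓝 0) := fun v => by
    have h1 := strong Q hQ (circleFun f v)
    have h2 := (X.continuous.tendsto 0).comp (strong Q hQ v)
    have h3 := (h1.add (by simpa using h2)).add (strong K hK v)
    rw [add_zero, add_zero] at h3
    refine h3.congr fun n => ?_
    rw [hR, _root_.add_apply, _root_.add_apply, mul_apply_eq_comp, mul_apply_eq_comp,
      ← mul_apply_eq_comp (circleFun f), circleFun_comm_zpow, mul_apply_eq_comp]
    rfl
  rw [← norm_circleFun]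
  refine ContinuousLinearMap.opNorm_le_bound _ (norm_nonneg _) fun v => ?_
  have hlim := ((hRv v).norm.const_add (‖T‖ * ‖v‖))
  rw [norm_zero, add_zero] at hlim
  refine ge_of_tendsto' hlim fun n => ?_
  have e : circleFun f (((U ^ c n : unitary Op) : Op) v) =
      T (((U ^ c n : unitary Op) : Op) v) +
        (circleFun f - T) (((U ^ c n : unitary Op) : Op) v) := by
    rw [_root_.sub_apply]; abel
  -- The norm of f(U)v is unchanged by the unitary shift, which commutes with f(U). On the shifted
  -- vector f(U) may be replaced by T up to an error tending to 0.
  rw [← norm_zpow_apply (c n) (circleFun f v), ← mul_apply_eq_comp, ← circleFun_comm_zpow,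
    mul_apply_eq_comp, e]
  refine (norm_add_le _ _).trans (add_le_add_left ?_ _)
  have := T.le_opNorm (((U ^ c n : unitary Op) : Op) v)
  rwa [norm_zpow_apply] at this

/-- The symbol is norm decreasing. -/
theorem norm_le_of_isNegligible {T : Op} {f g : C(Circle, ℂ)} (h : IsNegligible (T - toeplitz f g)) :
    ‖f‖ ≤ ‖T‖ ∧ ‖g‖ ≤ ‖T‖ := by
  have hT := fun (c : ℕ → ℤ) => tendsto_apply_E h.neg c
  constructor
  -- From f(U) - T_{f,g} = Q f(U) + (P f(U) - Q g(U)) Q, with P = P_{≥0} and Q = P_{<0}. Shifting to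
  -- +∞ moves each basis vector out of the range of Q; the other half exchanges P with Q and shifts
  -- to -∞.
  · refine norm_le_of_asymptotic (Q := PNeg) (X := PNonneg * circleFun f - PNeg * circleFun g)
      (K := -(T - toeplitz f g)) (c := fun n => n) ?_ (fun k => ?_)
      (fun k => hT _ fun m => ?_)
    · rw [toeplitz, PNeg_eq]; noncomm_ring
    · refine tendsto_const_nhds.congr' ((eventually_ge_atTop k.natAbs).mono fun n hn => ?_)
      change 0 = PNeg _
      rw [PNeg, diag_E, indicatorSeq_apply, if_neg (by omega), zero_smul]
    · filter_upwards [eventually_ge_atTop (k.natAbs + m)] with n hn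
      omega
  · refine norm_le_of_asymptotic (Q := PNonneg) (X := PNeg * circleFun g - PNonneg * circleFun f)
      (K := -(T - toeplitz f g)) (c := fun n => -n) ?_ (fun k => ?_)
      (fun k => hT _ fun m => ?_)
    · rw [toeplitz, PNeg_eq]; noncomm_ring
    · refine tendsto_const_nhds.congr' ((eventually_ge_atTop (k.natAbs + 1)).mono fun n hn => ?_)
      change 0 = PNonneg _
      rw [PNonneg, diag_E, indicatorSeq_apply, if_neg (by omega), zero_smul]
    · filter_upwards [eventually_ge_atTop (k.natAbs + m + 1)] with n hn
      omega

theorem norm_toeplitz_le (f g : C(Circle, ℂ)) : ‖toeplitz f g‖ ≤ ‖f‖ + ‖g‖ := by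
  have key : ∀ (P : Op) (h : C(Circle, ℂ)), ‖P‖ ≤ 1 → ‖P * circleFun h * P‖ ≤ ‖h‖ := fun P h hP =>
    calc ‖P * circleFun h * P‖ ≤ ‖P * circleFun h‖ * ‖P‖ := norm_mul_le _ _
      _ ≤ ‖P * circleFun h‖ := mul_le_of_le_one_right (norm_nonneg _) hP
      _ ≤ ‖P‖ * ‖circleFun h‖ := norm_mul_le _ _
      _ ≤ ‖h‖ := by
        rw [norm_circleFun]; exact mul_le_of_le_one_left (norm_nonneg _) hP
  exact (norm_add_le _ _).trans
    (add_le_add (key _ f norm_PNonneg_le) (key _ g norm_PNeg_le))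

theorem tendsto_toeplitz {f g : ℕ → C(Circle, ℂ)} {f₀ g₀ : C(Circle, ℂ)}
    (hf : Tendsto f atTop (𝓝 f₀)) (hg : Tendsto g atTop (𝓝 g₀)) :
    Tendsto (fun n => toeplitz (f n) (g n)) atTop (𝓝 (toeplitz f₀ g₀)) := by
  have h := (tendsto_iff_norm_sub_tendsto_zero.1 hf).add (tendsto_iff_norm_sub_tendsto_zero.1 hg)
  rw [add_zero] at h
  refine tendsto_iff_norm_sub_tendsto_zero.2 (squeeze_zero (fun _ => norm_nonneg _) (fun n => ?_) h)
  rw [← toeplitz_sub]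
  exact norm_toeplitz_le _ _

/-! ### The symbol calculus on the quantum cylinder. -/

/-- `T = T_{f,g}` modulo negligible operators. -/
def HasSymbol (T : Op) (f g : C(Circle, ℂ)) : Prop := IsNegligible (T - toeplitz f g)

theorem HasSymbol.hasBoundarySymbol {T : Op} {f g : C(Circle, ℂ)} (h : HasSymbol T f g) :
    HasBoundarySymbol T f g :=
  h.isCompactOperator

theorem HasSymbol.add {S T : Op} {f g f' g' : C(Circle, ℂ)} (hS : HasSymbol S f g)
    (hT : HasSymbol T f' g') : HasSymbol (S + T) (f + f') (g + g') := by
  change IsNegligible _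
  convert IsNegligible.add hS hT using 1
  rw [toeplitz_add]; abel

theorem HasSymbol.neg {T : Op} {f g : C(Circle, ℂ)} (hT : HasSymbol T f g) :
    HasSymbol (-T) (-f) (-g) := by
  change IsNegligible _
  convert IsNegligible.neg hT using 1
  rw [toeplitz_neg_neg]; abel

theorem HasSymbol.sub {S T : Op} {f g f' g' : C(Circle, ℂ)} (hS : HasSymbol S f g)
    (hT : HasSymbol T f' g') : HasSymbol (S - T) (f - f') (g - g') := by
  simpa only [sub_eq_add_neg] using hS.add hT.neg

theorem HasSymbol.mul {S T : Op} {f g f' g' : C(Circle, ℂ)} (hS : HasSymbol S f g)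
    (hT : HasSymbol T f' g') : HasSymbol (S * T) (f * f') (g * g') := by
  have h1 := IsNegligible.mul_right hS T
  have h2 := IsNegligible.mul_left hT (toeplitz f g)
  change IsNegligible _
  convert (h1.add h2).add (isNegligible_toeplitz_mul f g f' g') using 1
  noncomm_ring

theorem HasSymbol.star {T : Op} {f g : C(Circle, ℂ)} (hT : HasSymbol T f g) :
    HasSymbol (star T) (star f) (star g) := by
  change IsNegligible _
  convert IsNegligible.star hT using 1
  rw [star_sub, star_toeplitz]

theorem hasSymbol_zero_iff {T : Op} : HasSymbol T 0 0 ↔ IsNegligible T := by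
  have : toeplitz 0 0 = 0 := by simpa using toeplitz_smul 0 0 0
  rw [HasSymbol, this, sub_zero]

theorem hasSymbol_toeplitz (f g : C(Circle, ℂ)) : HasSymbol (toeplitz f g) f g := by
  rw [HasSymbol, sub_self]; exact IsNegligible.zero

theorem HasSymbol.unique {T : Op} {f g f' g' : C(Circle, ℂ)} (h : HasSymbol T f g)
    (h' : HasSymbol T f' g') : f = f' ∧ g = g' := by
  have hs := h.sub h'
  rw [sub_self] at hs
  have := norm_le_of_isNegligible hs
  rw [norm_zero, norm_le_zero_iff, norm_le_zero_iff, sub_eq_zero, sub_eq_zero] at this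
  exact this

theorem hasSymbol_U : HasSymbol (U : Op) circleCoord circleCoord := by
  have h := isNegligible_commutator_circleFun circleCoord
  -- The off-diagonal corners of U are P [P, U] and -Q [P, U].
  have h1 := (h.mul_left PNonneg).sub (h.mul_left PNeg)
  rw [HasSymbol, toeplitz, circleFun_coord]
  rw [circleFun_coord] at h1
  convert h1 using 1
  have hP := PNonneg_mul_self
  rw [PNeg_eq]
  generalize PNonneg = p at *
  have e : ∀ x : Op, p * (p * x) = p * x := fun x => by rw [← mul_assoc, hP]
  simp only [mul_sub, sub_mul, mul_one, one_mul, mul_assoc, e]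
  abel

/-- Subtracting the limits on the two half-lines leaves a diagonal operator whose entries vanish at
both ends. -/
theorem hasSymbol_diag {a : BddSeq} {r s : ℂ} (hr : Tendsto (fun k : ℤ => a k) atTop (𝓝 r))
    (hs : Tendsto (fun k : ℤ => a k) atBot (𝓝 s)) : HasSymbol (diag a) (r • 1) (s • 1) := by
  have e : diag a - toeplitz (r • 1) (s • 1) =
      diag (a - (r • (indicatorSeq fun k => 0 ≤ k) + s • indicatorSeq fun k => k < 0)) := by
    rw [toeplitz_const]
    refine op_ext fun f k => ?_
    simp only [PNonneg, PNeg, _root_.sub_apply, _root_.add_apply, _root_.smul_apply, diag_apply,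
      lp.coeFn_sub, Pi.sub_apply, lp.coeFn_add, Pi.add_apply, lp.coeFn_smul, Pi.smul_apply,
      smul_eq_mul]
    ring
  rw [HasSymbol, e]
  refine isNegligible_diag ?_ ?_
  · rw [← sub_self r]
    refine (hr.sub_const r).congr' ((eventually_ge_atTop 0).mono fun k hk => ?_)
    simp only [lp.coeFn_sub, Pi.sub_apply, lp.coeFn_add, Pi.add_apply, lp.coeFn_smul,
      Pi.smul_apply]
    simp [hk, not_lt.2 hk]
  · rw [← sub_self s]
    refine (hs.sub_const s).congr' ((eventually_lt_atBot 0).mono fun k hk => ?_)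
    simp only [lp.coeFn_sub, Pi.sub_apply, lp.coeFn_add, Pi.add_apply, lp.coeFn_smul,
      Pi.smul_apply]
    simp [hk, not_le.2 hk]

theorem hasSymbol_algebraMap (c : ℂ) : HasSymbol (algebraMap ℂ Op c) (c • 1) (c • 1) := by
  rw [HasSymbol, toeplitz_const, ← smul_add, PNonneg_add_PNeg, Algebra.algebraMap_eq_smul_one,
    sub_self]
  exact IsNegligible.zero

/-- Symbols depend contractively on the operator, so along a convergent sequence they are Cauchy;
negligibility of the difference passes to the limit. -/
theorem isClosed_hasSymbol : IsClosed {T : Op | ∃ f g, HasSymbol T f g} := by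
  refine IsSeqClosed.isClosed fun T T₀ hT hlim => ?_
  choose f g h using hT
  have hc := hlim.cauchySeq
  have cauchy : ∀ u : ℕ → C(Circle, ℂ), (∀ n m, ‖u n - u m‖ ≤ ‖T n - T m‖) → CauchySeq u := by
    intro u hu
    rw [Metric.cauchySeq_iff] at hc ⊢
    intro ε hε
    obtain ⟨N, hN⟩ := hc ε hε
    refine ⟨N, fun m hm n hn => ?_⟩
    have := hN m hm n hn
    rw [dist_eq_norm] at this ⊢
    exact (hu m n).trans_lt this
  obtain ⟨f₀, hf⟩ := cauchySeq_tendsto_of_complete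
    (cauchy f fun n m => (norm_le_of_isNegligible ((h n).sub (h m))).1)
  obtain ⟨g₀, hg⟩ := cauchySeq_tendsto_of_complete
    (cauchy g fun n m => (norm_le_of_isNegligible ((h n).sub (h m))).2)
  exact ⟨f₀, g₀, isClosed_isNegligible.mem_of_tendsto (hlim.sub (tendsto_toeplitz hf hg))
    (Eventually.of_forall h)⟩

/-- Every element of the quantum cylinder has a symbol. -/
theorem exists_hasSymbol {T : Op} (hT : T ∈ cylinder) : ∃ f g, HasSymbol T f g := by
  let S : StarSubalgebra ℂ Op :=
    { carrier := {T | ∃ f g, HasSymbol T f g}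
      mul_mem' := fun ⟨_, _, ha⟩ ⟨_, _, hb⟩ => ⟨_, _, ha.mul hb⟩
      add_mem' := fun ⟨_, _, ha⟩ ⟨_, _, hb⟩ => ⟨_, _, ha.add hb⟩
      algebraMap_mem' := fun c => ⟨_, _, hasSymbol_algebraMap c⟩
      star_mem' := fun ⟨_, _, ha⟩ => ⟨_, _, ha.star⟩ }
  have hle : cylinder ≤ S := by
    refine StarSubalgebra.topologicalClosure_minimal (StarAlgebra.adjoin_le ?_) isClosed_hasSymbol
    rintro _ (rfl | ⟨a, ⟨r, s, hr, hs⟩, rfl⟩)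
    · exact ⟨_, _, hasSymbol_U⟩
    · exact ⟨_, _, hasSymbol_diag hr hs⟩
  exact hle hT

/-- Symbols multiply in a commutative algebra, so S T and T S have the same symbol. -/
theorem isNegligible_commutator {S T : Op} (hS : S ∈ cylinder) (hT : T ∈ cylinder) :
    IsNegligible (S * T - T * S) := by
  obtain ⟨f, g, h⟩ := exists_hasSymbol hS
  obtain ⟨f', g', h'⟩ := exists_hasSymbol hT
  have := (h.mul h').sub (h'.mul h)
  rwa [mul_comm f' f, mul_comm g' g, sub_self, sub_self, hasSymbol_zero_iff] at this

theorem PNonneg_mem_cylinder : PNonneg ∈ cylinder :=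
  diag_mem_cylinder isEventuallyConstant_nonneg.isConvergent

theorem PZero_mem_cylinder : PZero ∈ cylinder :=
  diag_mem_cylinder isEventuallyConstant_zero.isConvergent

theorem zpow_mem_cylinder (n : ℤ) : ((U ^ n : unitary Op) : Op) ∈ cylinder := by
  induction n using Int.induction_on with
  | zero => simp [one_mem]
  | succ n ih =>
    rw [zpow_add, zpow_one, Submonoid.coe_mul]
    exact mul_mem ih U_mem_cylinder
  | pred n ih =>
    rw [sub_eq_add_neg, zpow_add, zpow_neg_one, Submonoid.coe_mul]
    exact mul_mem ih U_inv_mem_cylinder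

theorem mem_cylinder_of_mem_polyAlg {T : Op} (hT : T ∈ polyAlg) : T ∈ cylinder := by
  have h : Algebra.adjoin ℂ gens ≤ cylinder.toSubalgebra := by
    refine Algebra.adjoin_le ?_
    rintro x (rfl | rfl | rfl | rfl)
    · exact U_mem_cylinder
    · exact U_inv_mem_cylinder
    · exact PNonneg_mem_cylinder
    · exact PZero_mem_cylinder
  exact h (polyAlg_le_adjoin hT)

/-! ### Derivations and their values on generators and idempotents. -/

theorem IsDerivation.sub {D D' : polyAlg →ₗ[ℂ] cylinder} (h : IsDerivation D)
    (h' : IsDerivation D') : IsDerivation (D - D') := fun a b => by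
  simp only [LinearMap.sub_apply, AddSubgroupClass.coe_sub, h a b, h' a b]
  noncomm_ring

/-- The inner derivation `a ↦ [x, a]`. -/
noncomputable def innerDerivation (x : cylinder) : polyAlg →ₗ[ℂ] cylinder where
  toFun a := x * ⟨a, mem_cylinder_of_mem_polyAlg a.2⟩ - ⟨a, mem_cylinder_of_mem_polyAlg a.2⟩ * x
  map_add' a b := Subtype.ext <| by
    change (x : Op) * ((a : Op) + b) - ((a : Op) + b) * x =
      ((x : Op) * a - a * x) + ((x : Op) * b - b * x)
    noncomm_ring
  map_smul' c a := Subtype.ext <| by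
    change (x : Op) * (c • (a : Op)) - (c • (a : Op)) * x = c • ((x : Op) * a - a * x)
    rw [mul_smul_comm, smul_mul_assoc, smul_sub]

theorem innerDerivation_apply (x : cylinder) (a : polyAlg) :
    (innerDerivation x a : Op) = x * (a : Op) - (a : Op) * x := rfl

theorem isDerivation_innerDerivation (x : cylinder) : IsDerivation (innerDerivation x) :=
  fun a b => by
    simp only [innerDerivation_apply, MulMemClass.coe_mul]
    noncomm_ring

theorem IsDerivation.map_U_inv {D : polyAlg →ₗ[ℂ] cylinder} (h : IsDerivation D) :
    (D ⟨_, U_inv_mem_polyAlg⟩ : Op) =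
      -(((U⁻¹ : unitary Op) : Op) * D ⟨_, U_mem_polyAlg⟩ * ((U⁻¹ : unitary Op) : Op)) := by
  have e := h ⟨_, U_inv_mem_polyAlg⟩ ⟨_, U_mem_polyAlg⟩
  have e1 : (⟨_, U_inv_mem_polyAlg⟩ : polyAlg) * ⟨_, U_mem_polyAlg⟩ = 1 :=
    Subtype.ext U_inv_mul_U
  rw [e1, h.map_one] at e
  have e2 := congrArg (fun z : Op => z * ((U⁻¹ : unitary Op) : Op)) e
  simp only [ZeroMemClass.coe_zero, zero_mul, add_mul, mul_assoc, U_mul_U_inv, mul_one] at e2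
  rw [mul_assoc]
  exact eq_neg_of_add_eq_zero_left e2.symm

/-- A property of elements of `𝒜` that is stable under the algebra operations holds everywhere as
soon as it holds for the generators. -/
theorem polyAlg_induction {motive : polyAlg → Prop} (hU : motive ⟨_, U_mem_polyAlg⟩)
    (hV : motive ⟨_, U_inv_mem_polyAlg⟩) (hP : motive ⟨_, PNonneg_mem_polyAlg⟩)
    (hZ : motive ⟨_, PZero_mem_polyAlg⟩) (hc : ∀ c : ℂ, motive (algebraMap ℂ polyAlg c))
    (hadd : ∀ a b, motive a → motive b → motive (a + b))
    (hmul : ∀ a b, motive a → motive b → motive (a * b)) (a : polyAlg) : motive a := by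
  have key : ∀ x ∈ Algebra.adjoin ℂ gens, ∃ hx : x ∈ polyAlg, motive ⟨x, hx⟩ := by
    intro x hx
    induction hx using Algebra.adjoin_induction with
    | mem x hx =>
      rcases hx with rfl | rfl | rfl | rfl
      exacts [⟨_, hU⟩, ⟨_, hV⟩, ⟨_, hP⟩, ⟨_, hZ⟩]
    | algebraMap c => exact ⟨_, hc c⟩
    | add x y _ _ hx hy =>
      obtain ⟨_, hx⟩ := hx
      obtain ⟨_, hy⟩ := hy
      exact ⟨_, hadd _ _ hx hy⟩
    | mul x y _ _ hx hy =>
      obtain ⟨_, hx⟩ := hx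
      obtain ⟨_, hy⟩ := hy
      exact ⟨_, hmul _ _ hx hy⟩
  exact (key a (polyAlg_le_adjoin a.2)).2

theorem IsDerivation.map_algebraMap {D : polyAlg →ₗ[ℂ] cylinder} (h : IsDerivation D) (c : ℂ) :
    D (algebraMap ℂ polyAlg c) = 0 := by
  rw [Algebra.algebraMap_eq_smul_one, map_smul, h.map_one, smul_zero]

/-- Inner derivations that approximate `D` on `U`, `P_{≥0}` and `P₀` approximate it everywhere. -/
theorem IsDerivation.isApproximatelyInner {D : polyAlg →ₗ[ℂ] cylinder} (h : IsDerivation D)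
    (x : ℕ → cylinder)
    (hU : Tendsto (fun n => (x n : Op) * U - U * (x n : Op)) atTop (𝓝 (D ⟨_, U_mem_polyAlg⟩ : Op)))
    (hP : Tendsto (fun n => (x n : Op) * PNonneg - PNonneg * (x n : Op)) atTop
      (𝓝 (D ⟨_, PNonneg_mem_polyAlg⟩ : Op)))
    (hZ : Tendsto (fun n => (x n : Op) * PZero - PZero * (x n : Op)) atTop
      (𝓝 (D ⟨_, PZero_mem_polyAlg⟩ : Op))) : IsApproximatelyInner D := by
  refine ⟨x, polyAlg_induction hU ?_ hP hZ (fun c => ?_) (fun a b ha hb => ?_)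
    fun a b ha hb => ?_⟩
  -- Inner derivations obey the same rule for U⁻¹, so convergence at U gives convergence at U⁻¹.
  · rw [h.map_U_inv]
    refine ((hU.const_mul ((U⁻¹ : unitary Op) : Op)).mul_const ((U⁻¹ : unitary Op) : Op)).neg.congr
      fun n => ?_
    simp only [mul_sub, sub_mul, mul_assoc, U_mul_U_inv, mul_one]
    simp only [← mul_assoc, U_inv_mul_U, one_mul, neg_sub]
  · rw [h.map_algebraMap]
    refine tendsto_const_nhds.congr fun n => ?_
    rw [Subalgebra.coe_algebraMap, ← Algebra.commutes, sub_self]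
    rfl
  · rw [map_add]
    refine (ha.add hb).congr fun n => ?_
    rw [AddMemClass.coe_add]
    noncomm_ring
  · rw [h]
    refine ((ha.mul_const (b : Op)).add (hb.const_mul (a : Op))).congr fun n => ?_
    rw [MulMemClass.coe_mul]
    noncomm_ring

/-- A derivation agrees on a given idempotent with an inner derivation. -/
theorem IsDerivation.eq_commutator_of_idempotent {D : polyAlg →ₗ[ℂ] cylinder} (h : IsDerivation D)
    {p : polyAlg} (hp : p * p = p) :
    (D p : Op) = ((D p : Op) * p - p * (D p : Op)) * p - p * ((D p : Op) * p - p * (D p : Op)) := by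
  have e := h p p
  have hp' : (p : Op) * p = p := congrArg Subtype.val hp
  rw [hp] at e
  generalize (D p : Op) = δ at *
  generalize (p : Op) = q at *
  -- Compressing δ = δq + qδ by q gives qδq = 2qδq. Then [[δ, q], q] = δq + qδ - 2qδq = δ.
  have e0 : q * δ * q = 0 := by
    have e1 := congrArg (fun t => q * t * q) e
    simp only [mul_add, add_mul] at e1
    rw [mul_assoc q (δ * q) q, mul_assoc δ, hp', ← mul_assoc q q δ, hp', ← mul_assoc] at e1
    exact left_eq_add.1 e1
  rw [sub_mul, mul_sub, mul_assoc δ, hp', ← mul_assoc q q, hp', ← mul_assoc, e0, sub_zero,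
    zero_sub, sub_neg_eq_add, ← e]

/-- A derivation agrees on `P_{≥0}` and `P₀` with an inner derivation. -/
theorem IsDerivation.exists_eq_innerDerivation {D : polyAlg →ₗ[ℂ] cylinder} (h : IsDerivation D) :
    ∃ x : cylinder, D ⟨_, PNonneg_mem_polyAlg⟩ = innerDerivation x ⟨_, PNonneg_mem_polyAlg⟩ ∧
      D ⟨_, PZero_mem_polyAlg⟩ = innerDerivation x ⟨_, PZero_mem_polyAlg⟩ := by
  set p : polyAlg := ⟨_, PNonneg_mem_polyAlg⟩ with hp
  set z : polyAlg := ⟨_, PZero_mem_polyAlg⟩ with hz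
  have hpp : p * p = p := Subtype.ext PNonneg_mul_self
  have hzz : z * z = z := Subtype.ext <| op_ext fun f k => by
    simp only [hz, MulMemClass.coe_mul, mul_apply_eq_comp, PZero_apply]
    split_ifs <;> rfl
  have hpz : p * z = z := Subtype.ext <| op_ext fun f k => by
    simp only [hp, hz, MulMemClass.coe_mul, mul_apply_eq_comp, PZero_apply, PNonneg_apply]
    split_ifs <;> first | rfl | omega
  have hzp : z * p = z := Subtype.ext <| op_ext fun f k => by
    simp only [hp, hz, MulMemClass.coe_mul, mul_apply_eq_comp, PZero_apply, PNonneg_apply]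
    split_ifs <;> first | rfl | omega
  have comm : ∀ (T : cylinder) (a : polyAlg), (T : Op) * a - a * T ∈ cylinder := fun T a =>
    sub_mem (mul_mem T.2 (mem_cylinder_of_mem_polyAlg a.2))
      (mul_mem (mem_cylinder_of_mem_polyAlg a.2) T.2)
  let x₁ : cylinder := ⟨_, comm (D z) z⟩
  -- The value at P₀ is removed first, so that the correction for P_{≥0} does not disturb it.
  set D₁ := D - innerDerivation x₁ with hD₁
  have h₁ : IsDerivation D₁ := h.sub (isDerivation_innerDerivation x₁)
  have hz₁ : D₁ z = 0 := by
    rw [hD₁, LinearMap.sub_apply, sub_eq_zero]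
    exact Subtype.ext (h.eq_commutator_of_idempotent hzz)
  let x₂ : cylinder := ⟨_, comm (D₁ p) p⟩
  have hp₂ : D₁ p = innerDerivation x₂ p := Subtype.ext (h₁.eq_commutator_of_idempotent hpp)
  -- Since pz = zp = z and D₁ z = 0, the Leibniz rule gives (D₁ p) z = z (D₁ p) = 0. Thus x₂ = [D₁
  -- p, p] is annihilated by z on both sides.
  have hz₂ : innerDerivation x₂ z = 0 := by
    have e1 := h₁ p z
    have e2 := h₁ z p
    rw [hpz, hz₁, ZeroMemClass.coe_zero, mul_zero, add_zero] at e1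
    rw [hzp, hz₁, ZeroMemClass.coe_zero, zero_mul, zero_add] at e2
    have e3 : (p : Op) * z = z := congrArg Subtype.val hpz
    have e4 : (z : Op) * p = z := congrArg Subtype.val hzp
    refine Subtype.ext ?_
    change ((D₁ p : Op) * p - p * (D₁ p : Op)) * z - z * ((D₁ p : Op) * p - p * (D₁ p : Op)) = 0
    rw [sub_mul, mul_sub, mul_assoc, e3, mul_assoc _ _ (z : Op), ← e1, ← mul_assoc, ← e2,
      ← mul_assoc, e4, ← e2]
    simp
  have hadd : ∀ a, innerDerivation (x₁ + x₂) a = innerDerivation x₁ a + innerDerivation x₂ a :=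
    fun a => Subtype.ext <| by
      simp only [innerDerivation_apply, AddMemClass.coe_add]
      noncomm_ring
  refine ⟨x₁ + x₂, ?_, ?_⟩
  · rw [hadd, ← hp₂, hD₁, LinearMap.sub_apply, add_sub_cancel]
  · rw [hadd, hz₂, add_zero, ← sub_eq_zero]
    exact hz₁

/-! ### Solving the commutator equation for finite matrices. -/

/-- `K` is solvable if `U K = [y, U]` for some `y ∈ A` that commutes with `P_{≥0}` and `P₀`. -/
noncomputable def solvable : Submodule ℂ Op where
  carrier := {K | ∃ y ∈ cylinder, y * U - U * y = U * K ∧ y * PNonneg = PNonneg * y ∧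
    y * PZero = PZero * y}
  zero_mem' := ⟨0, zero_mem _, by simp, by simp, by simp⟩
  add_mem' := by
    rintro K L ⟨y, hy, h1, h2, h3⟩ ⟨w, hw, g1, g2, g3⟩
    refine ⟨y + w, add_mem hy hw, ?_, ?_, ?_⟩
    · rw [mul_add (U : Op) K L, ← h1, ← g1]; noncomm_ring
    · rw [add_mul, mul_add, h2, g2]
    · rw [add_mul, mul_add, h3, g3]
  smul_mem' := by
    rintro c K ⟨y, hy, h1, h2, h3⟩
    refine ⟨c • y, Subalgebra.smul_mem cylinder.toSubalgebra hy c, ?_, ?_, ?_⟩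
    · rw [mul_smul_comm, smul_mul_assoc, mul_smul_comm, ← smul_sub, h1]
    · rw [smul_mul_assoc, mul_smul_comm, h2]
    · rw [smul_mul_assoc, mul_smul_comm, h3]

theorem isConvergent_gt (j : ℤ) : IsConvergent (indicatorSeq fun l => j < l) :=
  ⟨1, 0, tendsto_const_nhds.congr' ((eventually_gt_atTop j).mono fun k hk => by simp [hk]),
    tendsto_const_nhds.congr' ((eventually_le_atBot j).mono fun k hk => by simp [not_lt.2 hk])⟩

theorem isConvergent_le (j : ℤ) : IsConvergent (indicatorSeq fun l => l ≤ j) :=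
  ⟨0, 1, tendsto_const_nhds.congr' ((eventually_gt_atTop j).mono fun k hk => by simp [not_le.2 hk]),
    tendsto_const_nhds.congr' ((eventually_le_atBot j).mono fun k hk => by simp [hk])⟩

/-- The solution is the telescoping series y = ∑ e_{i+m, j+m} over m ≥ 1: in [y, U] only the column
j survives, where it equals E_{i+1}. For i, j ≥ 0 both the rows and the columns of y are strictly
positive, so y commutes with both projections. It is not compact, but its diagonal factor has limits
at ±∞, which puts y in the cylinder. -/
theorem matrixUnit_mem_solvable_of_nonneg {i j : ℤ} (hi : 0 ≤ i) (hj : 0 ≤ j) :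
    matrixUnit i j ∈ solvable := by
  refine ⟨((U ^ (i - j) : unitary Op) : Op) * diag (indicatorSeq fun l => j < l),
    mul_mem (zpow_mem_cylinder _) (diag_mem_cylinder (isConvergent_gt j)), ?_, ?_, ?_⟩ <;>
  refine op_ext fun f k => ?_
  · simp only [_root_.sub_apply, lp.coeFn_sub, Pi.sub_apply, mul_apply_eq_comp, U_zpow_apply,
      diag_apply, U_apply, matrixUnit_apply, lp.coeFn_smul, Pi.smul_apply, E_apply,
      indicatorSeq_apply, smul_eq_mul]
    rw [show k - 1 - (i - j) = k - (i - j) - 1 by ring]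
    by_cases h : k - 1 = i
    · rw [show k - (i - j) - 1 = j by omega]
      rw [if_pos (by omega), if_neg (by omega), if_pos h]
      ring
    · rw [if_neg h]
      split_ifs <;> first | omega | simp
  · simp only [mul_apply_eq_comp, U_zpow_apply, diag_apply, PNonneg_apply, indicatorSeq_apply]
    split_ifs <;> first | omega | simp
  · simp only [mul_apply_eq_comp, U_zpow_apply, diag_apply, PZero_apply, indicatorSeq_apply]
    split_ifs <;> first | omega | simp

/-- Here the series is summed towards -∞, y = -∑ e_{i-m, j-m} over m ≥ 0, which keeps rows and
columns negative. The minus sign compensates for the surviving term now coming from U y. -/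
theorem matrixUnit_mem_solvable_of_neg {i j : ℤ} (hi : i < 0) (hj : j < 0) :
    matrixUnit i j ∈ solvable := by
  refine ⟨-(((U ^ (i - j) : unitary Op) : Op) * diag (indicatorSeq fun l => l ≤ j)),
    neg_mem (mul_mem (zpow_mem_cylinder _) (diag_mem_cylinder (isConvergent_le j))), ?_, ?_, ?_⟩ <;>
  simp only [neg_mul, mul_neg, neg_inj, sub_neg_eq_add] <;>
  refine op_ext fun f k => ?_
  · simp only [_root_.add_apply, _root_.neg_apply, lp.coeFn_add, lp.coeFn_neg, Pi.neg_apply,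
      Pi.add_apply, mul_apply_eq_comp, U_zpow_apply,
      diag_apply, U_apply, matrixUnit_apply, lp.coeFn_smul, Pi.smul_apply, E_apply,
      indicatorSeq_apply, smul_eq_mul]
    rw [show k - 1 - (i - j) = k - (i - j) - 1 by ring]
    by_cases h : k - 1 = i
    · rw [show k - (i - j) - 1 = j by omega]
      rw [if_neg (by omega), if_pos (by omega), if_pos h]
      ring
    · rw [if_neg h]
      split_ifs <;> first | omega | simp
  · simp only [mul_apply_eq_comp, U_zpow_apply, diag_apply, PNonneg_apply, indicatorSeq_apply]
    split_ifs <;> first | omega | simp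
  · simp only [mul_apply_eq_comp, U_zpow_apply, diag_apply, PZero_apply, indicatorSeq_apply]
    split_ifs <;> first | omega | simp

theorem trunc_mul_trunc_mem_solvable {K : Op} (hK : K * PNonneg = PNonneg * K) (N : ℕ) :
    trunc N * K * trunc N ∈ solvable := by
  have e : ∀ i j, matrixUnit i i * K * matrixUnit j j = (K (E j) i) • matrixUnit i j := fun i j =>
    ContinuousLinearMap.ext fun f => by
      simp only [mul_apply_eq_comp, matrixUnit_apply, map_smul, _root_.smul_apply, smul_smul,
        mul_comm]
  -- Comparing entries in K P = P K shows that those with indices of opposite sides vanish; these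
  -- are the matrix units without a solution above.
  have h0 : ∀ i j : ℤ, (if 0 ≤ j then (1 : ℂ) else 0) * K (E j) i =
      if 0 ≤ i then K (E j) i else 0 := fun i j => by
    have h := congrArg (fun T : Op => T (E j) i) hK
    simp only [mul_apply_eq_comp, PNonneg_apply] at h
    rw [← h, PNonneg, diag_E, map_smul, lp.coeFn_smul, Pi.smul_apply, indicatorSeq_apply,
      smul_eq_mul]
  rw [trunc_eq_sum, Finset.sum_mul, Finset.sum_mul]
  simp only [Finset.mul_sum, e]
  refine sum_mem fun i _ => sum_mem fun j _ => ?_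
  have h := h0 i j
  rcases le_or_gt 0 i with hi | hi <;> rcases le_or_gt 0 j with hj | hj
  · exact Submodule.smul_mem _ _ (matrixUnit_mem_solvable_of_nonneg hi hj)
  · rw [if_pos hi, if_neg (not_le.2 hj), zero_mul] at h
    rw [← h, zero_smul]; exact zero_mem _
  · rw [if_neg (not_le.2 hi), if_pos hj, one_mul] at h
    rw [h, zero_smul]; exact zero_mem _
  · exact Submodule.smul_mem _ _ (matrixUnit_mem_solvable_of_neg hi hj)

/-! ### Approximate innerness detected by the value at U. -/

/-- A derivation with `D(U)` negligible is approximately inner. -/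
theorem IsDerivation.isApproximatelyInner_of_isNegligible {D : polyAlg →ₗ[ℂ] cylinder}
    (h : IsDerivation D) (hn : IsNegligible (D ⟨_, U_mem_polyAlg⟩ : Op)) :
    IsApproximatelyInner D := by
  obtain ⟨x, hxP, hxZ⟩ := h.exists_eq_innerDerivation
  set D₁ := D - innerDerivation x with hD₁
  have h₁ : IsDerivation D₁ := h.sub (isDerivation_innerDerivation x)
  have hP₁ : D₁ ⟨_, PNonneg_mem_polyAlg⟩ = 0 := by rw [hD₁, LinearMap.sub_apply, hxP, sub_self]
  have hZ₁ : D₁ ⟨_, PZero_mem_polyAlg⟩ = 0 := by rw [hD₁, LinearMap.sub_apply, hxZ, sub_self]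
  set u : polyAlg := ⟨_, U_mem_polyAlg⟩ with hu
  obtain ⟨K, hK⟩ : ∃ K : Op, K = ((U⁻¹ : unitary Op) : Op) * D₁ u := ⟨_, rfl⟩
  have hUK : (U : Op) * K = D₁ u := by rw [hK, ← mul_assoc, U_mul_U_inv, one_mul]
  have hKn : IsNegligible K := by
    rw [hK]
    refine IsNegligible.mul_left ?_ _
    -- The correction by an inner derivation changes the value at U only by a commutator in the
    -- cylinder.
    exact hn.sub (isNegligible_commutator x.2 U_mem_cylinder)
  -- Apply D₁ to U P = (P - P₀) U, where D₁ kills both projections: U K P = (P - P₀) U K = U P K,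
  -- and U cancels.
  have hKP : K * PNonneg = PNonneg * K := by
    have e1 := h₁ u ⟨_, PNonneg_mem_polyAlg⟩
    have e2 := h₁ (⟨_, PNonneg_mem_polyAlg⟩ - ⟨_, PZero_mem_polyAlg⟩) u
    have e3 : u * ⟨_, PNonneg_mem_polyAlg⟩ =
        (⟨_, PNonneg_mem_polyAlg⟩ - ⟨_, PZero_mem_polyAlg⟩) * u := Subtype.ext U_mul_PNonneg
    rw [map_sub, hP₁, hZ₁, sub_self, ZeroMemClass.coe_zero, zero_mul, zero_add, ← e3, e1, hP₁,
      ZeroMemClass.coe_zero, mul_zero, add_zero, ← hUK, AddSubgroupClass.coe_sub, ← mul_assoc,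
      ← U_mul_PNonneg, mul_assoc, mul_assoc] at e2
    have e4 := congrArg (fun T => ((U⁻¹ : unitary Op) : Op) * T) e2
    simpa only [← mul_assoc, U_inv_mul_U, one_mul] using e4
  -- The equation is solved exactly for each truncation of K. The y n need not converge, but U K_n =
  -- [y n, U] tends to U K, and commuting with the projections leaves the values there unchanged.
  choose y hy hyU hyP hyZ using trunc_mul_trunc_mem_solvable hKP
  refine h.isApproximatelyInner (fun n => x + ⟨y n, hy n⟩) ?_ ?_ ?_
  · have hlim := (hKn.tendsto_trunc_mul_trunc.const_mul (U : Op)).const_add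
      (innerDerivation x u : Op)
    have e : (innerDerivation x u : Op) + U * K = D u := by
      rw [hUK, hD₁, LinearMap.sub_apply, AddSubgroupClass.coe_sub, add_sub_cancel]
    rw [e] at hlim
    refine hlim.congr fun n => ?_
    rw [← hyU, innerDerivation_apply, AddMemClass.coe_add, hu]
    noncomm_ring
  · refine tendsto_const_nhds.congr fun n => ?_
    rw [hxP, innerDerivation_apply, AddMemClass.coe_add, add_mul, mul_add, hyP]
    abel
  · refine tendsto_const_nhds.congr fun n => ?_
    rw [hxZ, innerDerivation_apply, AddMemClass.coe_add, add_mul, mul_add, hyZ]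
    abel

theorem IsApproximatelyInner.isNegligible {D : polyAlg →ₗ[ℂ] cylinder}
    (h : IsApproximatelyInner D) (a : polyAlg) : IsNegligible (D a : Op) := by
  obtain ⟨x, hx⟩ := h
  exact isClosed_isNegligible.mem_of_tendsto (hx a) (Eventually.of_forall fun n =>
    isNegligible_commutator (x n).2 (mem_cylinder_of_mem_polyAlg a.2))

/-- A derivation differs from `d_{f,g}` by an approximately inner one if and only if `D(U)` has
symbol `(z f, z g)`. -/
theorem IsDerivation.isApproximatelyInner_sub_iff {D : polyAlg →ₗ[ℂ] cylinder} (h : IsDerivation D)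
    (f g : C(Circle, ℂ)) :
    IsApproximatelyInner (D - boundaryDerivation f g) ↔
      HasSymbol (((U⁻¹ : unitary Op) : Op) * D ⟨_, U_mem_polyAlg⟩) f g := by
  have hb := boundaryDerivation_spec f g
  have e : ((D - boundaryDerivation f g) ⟨_, U_mem_polyAlg⟩ : Op) =
      U * (((U⁻¹ : unitary Op) : Op) * D ⟨_, U_mem_polyAlg⟩ - toeplitz f g) := by
    rw [LinearMap.sub_apply, AddSubgroupClass.coe_sub, hb.map_U, mul_sub, ← mul_assoc, U_mul_U_inv,
      one_mul]
  constructor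
  · intro hi
    have := (hi.isNegligible ⟨_, U_mem_polyAlg⟩).mul_left ((U⁻¹ : unitary Op) : Op)
    rwa [e, ← mul_assoc, U_inv_mul_U, one_mul] at this
  · intro hs
    refine (h.sub hb.isDerivation).isApproximatelyInner_of_isNegligible ?_
    rw [e]
    exact hs.mul_left _

/-! ### The boundary derivation and the main theorem. -/

theorem hasCircleDeriv_const (c : ℂ) : HasCircleDeriv (c • 1) 0 := fun x => by
  simpa using hasDerivAt_const x c

theorem HasCircleDeriv.add {p q p' q' : C(Circle, ℂ)} (hp : HasCircleDeriv p p')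
    (hq : HasCircleDeriv q q') : HasCircleDeriv (p + q) (p' + q') := fun x => (hp x).add (hq x)

theorem HasCircleDeriv.mul {p q p' q' : C(Circle, ℂ)} (hp : HasCircleDeriv p p')
    (hq : HasCircleDeriv q q') : HasCircleDeriv (p * q) (p' * q + p * q') := fun x =>
  (hp x).mul (hq x)

theorem hasCircleDeriv_coord : HasCircleDeriv circleCoord (Complex.I • circleCoord) := fun x => by
  have h := ((Complex.ofRealCLM.hasDerivAt (x := x)).mul_const Complex.I).cexp
  change HasDerivAt (fun t : ℝ => (Circle.exp t : ℂ)) (Complex.I * (Circle.exp x : ℂ)) x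
  simpa [Circle.coe_exp, mul_comm] using h

theorem HasCircleDeriv.star {p p' : C(Circle, ℂ)} (hp : HasCircleDeriv p p') :
    HasCircleDeriv (star p) (star p') := fun x => (hp x).star

theorem liftsBoundary_boundaryDerivation (f g : C(Circle, ℂ)) :
    LiftsBoundary f g (boundaryDerivation f g) := by
  have hb := boundaryDerivation_spec f g
  set D := boundaryDerivation f g
  suffices H : ∀ a : polyAlg, ∃ p q p' q' : C(Circle, ℂ),
      HasSymbol (a : Op) p q ∧ HasCircleDeriv p p' ∧ HasCircleDeriv q q' ∧
      HasSymbol (D a : Op) (f * ((1 / Complex.I) • p')) (g * ((1 / Complex.I) • q')) by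
    intro a
    obtain ⟨p, q, p', q', h1, h2, h3, h4⟩ := H a
    exact ⟨p, q, p', q', h1.hasBoundarySymbol, h2, h3, h4.hasBoundarySymbol⟩
  have h0 : ∀ h : C(Circle, ℂ), h * ((1 / Complex.I) • (0 : C(Circle, ℂ))) = 0 := fun h => by
    rw [smul_zero, mul_zero]
  have hzero : HasSymbol 0 0 0 := hasSymbol_zero_iff.2 IsNegligible.zero
  have hV : HasSymbol ((U⁻¹ : unitary Op) : Op) (star circleCoord) (star circleCoord) := by
    simpa only [star_U] using hasSymbol_U.star
  refine polyAlg_induction ?_ ?_ ?_ ?_ (fun c => ?_) ?_ ?_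
  · refine ⟨_, _, _, _, hasSymbol_U, hasCircleDeriv_coord, hasCircleDeriv_coord, ?_⟩
    rw [hb.map_U]
    convert hasSymbol_U.mul (hasSymbol_toeplitz f g) using 1 <;>
      rw [smul_smul, one_div_mul_cancel Complex.I_ne_zero, one_smul, mul_comm]
  · refine ⟨_, _, _, _, hV, hasCircleDeriv_coord.star, hasCircleDeriv_coord.star, ?_⟩
    rw [hb.map_U_inv]
    -- The derivative of e^{-ix} is -i e^{-ix}, so (1/i) d/dx gives -e^{-ix}, matching d(U⁻¹) =
    -- -T_{f,g} U⁻¹.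
    convert ((hasSymbol_toeplitz f g).mul hV).neg using 1 <;>
      · ext z
        simp
        rw [← mul_assoc Complex.I, Complex.I_mul_I]
        ring
  -- P_{≥0} is T_{1,0}, whose symbol is locally constant on the two circles.
  · refine ⟨1, 0, 0, 0, ?_, by simpa using hasCircleDeriv_const 1,
      by simpa using hasCircleDeriv_const 0, ?_⟩
    · have := hasSymbol_toeplitz 1 0
      have e := toeplitz_const 1 0
      simp only [one_smul, zero_smul, add_zero] at e
      rwa [e] at this
    · rw [h0, h0, hb.map_PNonneg]; exact hzero
  · refine ⟨0, 0, 0, 0, hasSymbol_zero_iff.2 isNegligible_PZero,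
      by simpa using hasCircleDeriv_const 0, by simpa using hasCircleDeriv_const 0, ?_⟩
    rw [h0, h0, hb.map_PZero]; exact hzero
  · refine ⟨_, _, _, _, hasSymbol_algebraMap c, hasCircleDeriv_const c, hasCircleDeriv_const c, ?_⟩
    rw [h0, h0, hb.isDerivation.map_algebraMap]; exact hzero
  · rintro a b ⟨p, q, p', q', h1, h2, h3, h4⟩ ⟨r, s, r', s', k1, k2, k3, k4⟩
    refine ⟨_, _, _, _, h1.add k1, h2.add k2, h3.add k3, ?_⟩
    rw [map_add, AddMemClass.coe_add]
    convert h4.add k4 using 1 <;> rw [smul_add, mul_add]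
  · rintro a b ⟨p, q, p', q', h1, h2, h3, h4⟩ ⟨r, s, r', s', k1, k2, k3, k4⟩
    refine ⟨_, _, _, _, h1.mul k1, h2.mul k2, h3.mul k3, ?_⟩
    rw [hb.isDerivation]
    convert (h4.mul k1).add (h1.mul k4) using 1 <;>
      rw [smul_add, ← smul_mul_assoc, ← mul_smul_comm] <;> ring

end QuantumCylinder

theorem mainTheorem1 :
    (∀ f g : C(Circle, ℂ),
      QuantumCylinder.LiftsBoundary f g (QuantumCylinder.boundaryDerivation f g)) ∧
    ∀ d : QuantumCylinder.polyAlg →ₗ[ℂ] QuantumCylinder.cylinder,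
      QuantumCylinder.IsDerivation d →
        ∃! p : C(Circle, ℂ) × C(Circle, ℂ),
          ∃ d' : QuantumCylinder.polyAlg →ₗ[ℂ] QuantumCylinder.cylinder,
            QuantumCylinder.IsDerivation d' ∧ QuantumCylinder.IsApproximatelyInner d' ∧
              d = d' + QuantumCylinder.boundaryDerivation p.1 p.2 := by
  refine ⟨QuantumCylinder.liftsBoundary_boundaryDerivation, fun d hd => ?_⟩
  -- The pair is the symbol of U⁻¹d(U); uniqueness of the pair is uniqueness of this symbol.
  obtain ⟨f, g, h⟩ := QuantumCylinder.exists_hasSymbol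
    (mul_mem QuantumCylinder.U_inv_mem_cylinder (d ⟨_, QuantumCylinder.U_mem_polyAlg⟩).2)
  refine ⟨(f, g), ⟨_, hd.sub (QuantumCylinder.boundaryDerivation_spec f g).isDerivation,
    (hd.isApproximatelyInner_sub_iff f g).2 h, (sub_add_cancel _ _).symm⟩, ?_⟩
  rintro ⟨f', g'⟩ ⟨d', -, hi, e⟩
  rw [← sub_eq_iff_eq_add] at e
  rw [← e] at hi
  obtain ⟨rfl, rfl⟩ := h.unique ((hd.isApproximatelyInner_sub_iff f' g').1 hi)
  rfl
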